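/- Let $n,k\ge 1$ be integers and let $S$ be an unknown multiset of $k$ elements of $[n]=\{1,\dots,n\}$. In each round an algorithm, which may be randomized and adaptive and knows $n$, $k$ and $\delta$, queries an integer $q\in[n]$; an element $x$ of $S$ is drawn uniformly at random (with multiplicity, independently of all previous rounds), and the algorithm is told whether $x\le q$ or $x>q$. The algorithm may stop at any time and output a multiset. It determines $S$ with error $\delta$ if, for every multiset $S$ of $k$ elements of $[n]$, it stops and outputs $S$ with probability at least $1-\delta$. Let $W(n,k,\delta)$ be the least possible worst-case number of queries (over all $S$ and all random choices) of an algorithm that determines $S$ with error $\delta$, and let $E(n,k,\delta)$ be the infimum, over all such algorithms, of the expected number of queries on the worst $S$; thus $E(n,k,\delta)\le W(n,k,\delta)$. **Theorem 1.** There is an absolute constant $c>0$, and for every $\beta>0$ there is a constant $C>0$ depending only on $\beta$, such that for all integers $n,k\ge1$ and all real $\delta$ with $n^{-\beta}<\delta<1/4$: $$c\,k^3\log n\;\le\; E(n,k,\delta)\;\le\; W(n,k,\delta)\;\le\; C\,k^3\log n\qquad\text{if } k\le n,$$ $$c\,k^2 n\log n\;\le\; E(n,k,\delta)\;\le\; W(n,k,\delta)\;\le\;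 C\,k^2 n\log n\qquad\text{if } k\ge n.$$ In particular the number of queries needed, in the worst case as well as in expectation, is $\Theta(k^3\log n)$ when $k\le n$ and $\Theta(k^2n\log n)$ when $k\ge n$. -/

import Mathlib

open scoped ENNReal

noncomputable section

namespace HiddenMultiset

/-- The queries made so far together with the answers received, most recent first.
The integers `1, …, n` are represented, in order, by the elements of `Fin n`; the answer `true`
means "less than or equal", the answer `false` means "greater". -/
abbrev Transcript (n : ℕ) : Type := List (Fin n × Bool)

/-- A randomized adaptive algorithm: given the transcript so far, it chooses (with internal
randomness) either the next query `Sum.inl y`, or to stop with the output `Sum.inr R`.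
It need not stop within a bounded number of queries. -/
abbrev Algorithm (n : ℕ) : Type := Transcript n → PMF (Fin n ⊕ Multiset (Fin n))

/-- The random answer to the query `y`: a uniformly random element `x` of `S` (counted with
multiplicity) is drawn, and the answer tells whether `x ≤ y`. -/
def answer {n : ℕ} (S : Multiset (Fin n)) (hS : S ≠ 0) (y : Fin n) : PMF Bool :=
  (PMF.ofMultiset S hS).map fun x => decide (x ≤ y)

/-- The state of an execution: running with a given transcript, or stopped with a given output. -/
abbrev State (n : ℕ) : Type := Transcript n ⊕ Multiset (Fin n)

/-- One step of the execution of `A` on the hidden multiset `S`; each answer is drawn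
independently of everything that happened before. -/
def step {n : ℕ} (A : Algorithm n) (S : Multiset (Fin n)) (hS : S ≠ 0) :
    State n → PMF (State n)
  | Sum.inr R => PMF.pure (Sum.inr R)
  | Sum.inl h => (A h).bind fun a =>
      match a with
      | Sum.inl y => (answer S hS y).map fun b => Sum.inl ((y, b) :: h)
      | Sum.inr R => PMF.pure (Sum.inr R)

/-- The law of the state after `t` steps. -/
def run {n : ℕ} (A : Algorithm n) (S : Multiset (Fin n)) (hS : S ≠ 0) : ℕ → PMF (State n)
  | 0 => PMF.pure (Sum.inl [])
  | t + 1 => (run A S hS t).bind (step A S hS)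

/-- The probability that `A` stops and outputs exactly `S` (the probability of having done so
within `t` steps is nondecreasing in `t`). -/
def successProb {n : ℕ} (A : Algorithm n) (S : Multiset (Fin n)) (hS : S ≠ 0) : ℝ≥0∞ :=
  ⨆ t : ℕ, run A S hS t (Sum.inr S)

/-- The probability that `A` makes at least `t` queries, that is, that it is still running after
`t` steps. -/
def probAtLeast {n : ℕ} (A : Algorithm n) (S : Multiset (Fin n)) (hS : S ≠ 0) (t : ℕ) : ℝ≥0∞ :=
  ∑' h : Transcript n, run A S hS t (Sum.inl h)

/-- The expected number `E[T] = ∑_{t ≥ 1} P(T ≥ t)` of queries that `A` makes on `S`. -/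
def expectedQueries {n : ℕ} (A : Algorithm n) (S : Multiset (Fin n)) (hS : S ≠ 0) : ℝ≥0∞ :=
  ∑' t : ℕ, probAtLeast A S hS (t + 1)

/-- The largest number of queries that `A` makes on `S` with positive probability
(`∞` if there is no largest one). -/
def maxQueries {n : ℕ} (A : Algorithm n) (S : Multiset (Fin n)) (hS : S ≠ 0) : ℝ≥0∞ :=
  ⨆ (t : ℕ) (_ : probAtLeast A S hS t ≠ 0), (t : ℝ≥0∞)

/-- `A` determines every `k`-element multiset of integers in `{1, …, n}` with error at most `δ`. -/
def Determines {n : ℕ} (A : Algorithm n) (k : ℕ) (δ : ℝ) : Prop :=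
  ∀ (S : Multiset (Fin n)) (hS : S ≠ 0), S.card = k → ENNReal.ofReal (1 - δ) ≤ successProb A S hS

/-- The number of queries needed to determine a `k`-element multiset with error `δ`, where an
algorithm is charged its expected number of queries on the worst multiset. -/
def expectedComplexity (n k : ℕ) (δ : ℝ) : ℝ≥0∞ :=
  ⨅ (A : Algorithm n) (_ : Determines A k δ),
    ⨆ (S : Multiset (Fin n)) (hS : S ≠ 0) (_ : S.card = k), expectedQueries A S hS

/-- The number of queries needed to determine a `k`-element multiset with error `δ`, where an
algorithm is charged its worst-case number of queries, over all multisets and all random choices. -/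
def worstCaseComplexity (n k : ℕ) (δ : ℝ) : ℝ≥0∞ :=
  ⨅ (A : Algorithm n) (_ : Determines A k δ),
    ⨆ (S : Multiset (Fin n)) (hS : S ≠ 0) (_ : S.card = k), maxQueries A S hS

end HiddenMultiset

end

noncomputable section

namespace HiddenMultiset

/-! Both bounds have order `k ^ 2 * min k n * log n`; they are `lower_bound` and `upper_bound`.

Lower bound. For `k ≥ 3`, cut the range into `M`, about `min (k / 3) (n / 2)`, blocks, hide one
element in each, and pad with copies of the two end points so that the relevant answer probabilities
stay away from 0 and 1. Moving one element inside its block affects only queries in that block, and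
changes their answer probabilities by at most `1 / k`; such a query therefore carries divergence
`O(1 / k ^ 2)`. All `M * (m - 1)` neighbours of the hidden configuration share an output probability
of at most 1/4, so a typical neighbour is output with probability `O(1 / n)`, while it must be
output with probability above 3/4 when it is the truth. This requires divergence of order `log n`
for each block, even if the blocks are short. A query serves only one block, hence the factor `M`.
The divergence inequality is `change_of_measure`: it is linearized so as to survive induction on
transcripts, and its bound does not depend on the running time. The averaging is
`blocks_lower_bound`; `k < 3` is settled by counting in `log_le_of_determines`.

Upper bound. Use multiplicative weights, one system for each rank `j`. The probability of the answer
"at most" crosses `level j` exactly at the `j`-th smallest element, with margin `1 / (2 * k)` on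
both sides. So a query shrinks in expectation, by the factor `1 - 1 / (16 * k ^ 2)`, the relative
weight of each wrong candidate that it separates from the true one (`relWeight_step`). Querying a
weighted median or its predecessor for a random rank (`k ≤ n`), or a uniformly random integer (`n ≤
k`), separates on average a fraction of order `1 / min k n` of the wrong weight at every rank. The
potential starts below `2 * n ^ 2`, because only the first and last occurrences of each value have
to be tracked, and once it is below 1 the output is correct. -/

/-- The expectation of a nonnegative function under a probability mass function. -/
def expect {α : Type*} (p : PMF α) (f : α → ℝ≥0∞) : ℝ≥0∞ := ∑' a, p a * f a

/-! ### Calculus of expectations under a `PMF`. -/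

section expect

variable {α γ : Type*}

lemma expect_pure (a : α) (f : α → ℝ≥0∞) : expect (PMF.pure a) f = f a := by
  unfold expect
  rw [tsum_eq_single a]
  · simp
  · intro b hb
    simp [PMF.pure_apply, hb]

lemma expect_bind (p : PMF α) (q : α → PMF γ) (f : γ → ℝ≥0∞) :
    expect (p.bind q) f = expect p fun a => expect (q a) f := by
  simp only [expect, PMF.bind_apply, ← ENNReal.tsum_mul_right, ← ENNReal.tsum_mul_left]
  rw [ENNReal.tsum_comm]
  simp only [mul_assoc]

lemma expect_map (p : PMF α) (g : α → γ) (f : γ → ℝ≥0∞) :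
    expect (p.map g) f = expect p fun a => f (g a) := by
  simp only [PMF.map, expect_bind, Function.comp_def, expect_pure]

lemma expect_const (p : PMF α) (c : ℝ≥0∞) : expect p (fun _ => c) = c := by
  simp [expect, ENNReal.tsum_mul_right]

lemma expect_mono (p : PMF α) {f g : α → ℝ≥0∞} (h : ∀ a, f a ≤ g a) :
    expect p f ≤ expect p g :=
  ENNReal.tsum_le_tsum fun a => mul_le_mul_right (h a) _

lemma expect_le_const (p : PMF α) {f : α → ℝ≥0∞} {c : ℝ≥0∞} (h : ∀ a, f a ≤ c) :
    expect p f ≤ c :=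
  (expect_mono p h).trans (expect_const p c).le

lemma expect_add (p : PMF α) (f g : α → ℝ≥0∞) :
    expect p (fun a => f a + g a) = expect p f + expect p g := by
  simp [expect, mul_add, ENNReal.tsum_add]

lemma expect_const_mul (p : PMF α) (c : ℝ≥0∞) (f : α → ℝ≥0∞) :
    expect p (fun a => c * f a) = c * expect p f := by
  simp [expect, ← ENNReal.tsum_mul_left, mul_left_comm]

lemma expect_finset_sum {ι : Type*} (p : PMF α) (s : Finset ι) (f : ι → α → ℝ≥0∞) :
    expect p (fun a => ∑ i ∈ s, f i a) = ∑ i ∈ s, expect p (f i) := by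
  classical
  induction s using Finset.induction_on with
  | empty => simp [expect]
  | insert i s hi ih => simp [Finset.sum_insert hi, expect_add, ih]

lemma expect_bool (p : PMF Bool) (f : Bool → ℝ≥0∞) :
    expect p f = p true * f true + p false * f false := by
  simp [expect, tsum_fintype]

lemma hasSum_expect (p : PMF α) {f : α → ℝ≥0∞} {c : ℝ≥0∞} (hc : c ≠ ∞) (h : ∀ a, f a ≤ c) :
    HasSum (fun a => (p a).toReal * (f a).toReal) (expect p f).toReal := by
  have : ∑' a, p a * f a ≠ ∞ := ((expect_le_const p h).trans_lt hc.lt_top).ne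
  rw [expect, ENNReal.tsum_toReal_eq (ENNReal.ne_top_of_tsum_ne_top this)]
  simpa [ENNReal.toReal_mul] using ENNReal.hasSum_toReal this

end expect

/-! ### Executions under arbitrary answer laws, and their expected costs. -/

variable {n : ℕ}

/-- One step of the execution of `A` when the answer to the query `y` has law `ρ y`. -/
def stepWith (A : Algorithm n) (ρ : Fin n → PMF Bool) : State n → PMF (State n)
  | Sum.inr R => PMF.pure (Sum.inr R)
  | Sum.inl h => (A h).bind
      (Sum.elim (fun y => (ρ y).map fun b => Sum.inl ((y, b) :: h)) fun R => PMF.pure (Sum.inr R))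

/-- The law of the state `t` steps after a given state, when the answer to `y` has law `ρ y`. -/
def runFrom (A : Algorithm n) (ρ : Fin n → PMF Bool) : ℕ → State n → PMF (State n)
  | 0, s => PMF.pure s
  | t + 1, s => (stepWith A ρ s).bind (runFrom A ρ t)

lemma step_eq_stepWith (A : Algorithm n) (S : Multiset (Fin n)) (hS : S ≠ 0) :
    step A S hS = stepWith A (answer S hS) := by
  funext s
  rcases s with h | R
  · simp only [step, stepWith]
    congr 1
    funext a
    rcases a with y | R <;> rfl
  · rfl

/-- `run` appends steps at the end, whereas inductions over transcripts peel off the first step;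
this reconciles the two. -/
lemma runFrom_succ' (A : Algorithm n) (ρ : Fin n → PMF Bool) (t : ℕ) (s : State n) :
    runFrom A ρ (t + 1) s = (runFrom A ρ t s).bind (stepWith A ρ) := by
  induction t generalizing s with
  | zero => simp [runFrom, PMF.pure_bind]
  | succ t ih =>
    rw [runFrom, runFrom, PMF.bind_bind]
    congr 1
    funext s'
    exact ih s'

lemma run_eq_runFrom (A : Algorithm n) (S : Multiset (Fin n)) (hS : S ≠ 0) (t : ℕ) :
    run A S hS t = runFrom A (answer S hS) t (Sum.inl []) := by
  induction t with
  | zero => rfl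
  | succ t ih => rw [runFrom_succ', ← ih, run, step_eq_stepWith]

lemma runFrom_inr (A : Algorithm n) (ρ : Fin n → PMF Bool) (t : ℕ) (R : Multiset (Fin n)) :
    runFrom A ρ t (Sum.inr R) = PMF.pure (Sum.inr R) := by
  induction t with
  | zero => rfl
  | succ t ih => rw [runFrom, stepWith, PMF.pure_bind, ih]

/-- The expectation of `f` at the state reached `t` steps after the transcript `h`. -/
def runValue (A : Algorithm n) (ρ : Fin n → PMF Bool) (f : State n → ℝ≥0∞) (t : ℕ)
    (h : Transcript n) : ℝ≥0∞ :=
  expect (runFrom A ρ t (Sum.inl h)) f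

lemma runValue_zero (A : Algorithm n) (ρ : Fin n → PMF Bool) (f : State n → ℝ≥0∞)
    (h : Transcript n) : runValue A ρ f 0 h = f (Sum.inl h) :=
  expect_pure _ _

lemma runValue_succ (A : Algorithm n) (ρ : Fin n → PMF Bool) (f : State n → ℝ≥0∞) (t : ℕ)
    (h : Transcript n) :
    runValue A ρ f (t + 1) h = expect (A h)
      (Sum.elim (fun y => expect (ρ y) fun b => runValue A ρ f t ((y, b) :: h))
        fun R => f (Sum.inr R)) := by
  rw [runValue, runFrom, stepWith, PMF.bind_bind, expect_bind]
  congr 1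
  funext a
  rcases a with y | R
  · simp [expect_bind, runValue]
  · simp [runFrom_inr, expect_pure]

/-- The indicator of having stopped with output `R`. -/
def hasOutput (R : Multiset (Fin n)) : State n → ℝ≥0∞ := fun s =>
  open Classical in if s = Sum.inr R then 1 else 0

/-- The indicator of the running states. -/
def isRunning : State n → ℝ≥0∞ := Sum.elim (fun _ => 1) fun _ => 0

lemma hasOutput_inl (R : Multiset (Fin n)) (h : Transcript n) : hasOutput R (Sum.inl h) = 0 := by
  simp [hasOutput]

lemma hasOutput_self (R : Multiset (Fin n)) : hasOutput R (Sum.inr R) = 1 := by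
  simp [hasOutput]

lemma hasOutput_of_ne {R R' : Multiset (Fin n)} (h : R' ≠ R) : hasOutput R (Sum.inr R') = 0 := by
  simp [hasOutput, h]

lemma hasOutput_le_one (R : Multiset (Fin n)) (s : State n) : hasOutput R s ≤ 1 := by
  unfold hasOutput; split_ifs <;> simp

lemma expect_hasOutput (p : PMF (State n)) (R : Multiset (Fin n)) :
    expect p (hasOutput R) = p (Sum.inr R) := by
  unfold expect
  rw [tsum_eq_single (Sum.inr R)]
  · simp [hasOutput]
  · intro s hs
    simp [hasOutput, hs]

lemma runValue_hasOutput_le_one (A : Algorithm n) (ρ : Fin n → PMF Bool) (R : Multiset (Fin n))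
    (t : ℕ) (h : Transcript n) : runValue A ρ (hasOutput R) t h ≤ 1 :=
  expect_le_const _ (hasOutput_le_one R)

lemma successProb_eq (A : Algorithm n) (S : Multiset (Fin n)) (hS : S ≠ 0) :
    successProb A S hS = ⨆ t, runValue A (answer S hS) (hasOutput S) t [] := by
  simp [successProb, runValue, expect_hasOutput, run_eq_runFrom]

lemma probAtLeast_eq (A : Algorithm n) (S : Multiset (Fin n)) (hS : S ≠ 0) (t : ℕ) :
    probAtLeast A S hS t = runValue A (answer S hS) isRunning t [] := by
  rw [runValue, expect, probAtLeast, run_eq_runFrom]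
  rw [Summable.tsum_sum ENNReal.summable ENNReal.summable]
  simp [isRunning]

lemma probAtLeast_le_one (A : Algorithm n) (S : Multiset (Fin n)) (hS : S ≠ 0) (t : ℕ) :
    probAtLeast A S hS t ≤ 1 := by
  rw [probAtLeast_eq]
  refine expect_le_const _ fun s => ?_
  rcases s with h | R <;> simp [isRunning]

/-- The expected total cost of the queries made in the `t` steps after the transcript `h`,
where the query `y` costs `w y`. -/
def queryCost (A : Algorithm n) (ρ : Fin n → PMF Bool) (w : Fin n → ℝ≥0∞) :
    ℕ → Transcript n → ℝ≥0∞
  | 0, _ => 0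
  | t + 1, h => expect (A h)
      (Sum.elim (fun y => w y + expect (ρ y) fun b => queryCost A ρ w t ((y, b) :: h)) fun _ => 0)

lemma queryCost_one (A : Algorithm n) (ρ : Fin n → PMF Bool) (t : ℕ) (h : Transcript n) :
    queryCost A ρ (fun _ => 1) t h = ∑ s ∈ Finset.range t, runValue A ρ isRunning (s + 1) h := by
  induction t generalizing h with
  | zero => simp [queryCost]
  | succ t ih =>
    simp only [runValue_succ, ← expect_finset_sum]
    rw [queryCost]
    congr 1
    funext a
    rcases a with y | R
    · simp only [Sum.elim_inl, ih, Finset.sum_range_succ' _ t, runValue_zero, isRunning]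
      rw [← expect_finset_sum, add_comm]
      simp [expect_const]
    · simp [isRunning]

lemma queryCost_one_le_expectedQueries (A : Algorithm n) (S : Multiset (Fin n)) (hS : S ≠ 0)
    (t : ℕ) : queryCost A (answer S hS) (fun _ => 1) t [] ≤ expectedQueries A S hS := by
  rw [queryCost_one]
  simp only [← probAtLeast_eq]
  exact ENNReal.sum_le_tsum _

/-- A single query budget is shared among several cost functions. Applied to disjoint blocks, where
each query is charged to at most one block. -/
lemma sum_queryCost_le {ι : Type*} (I : Finset ι) (A : Algorithm n) (ρ : Fin n → PMF Bool)
    (w : ι → Fin n → ℝ≥0∞) (c : ℝ≥0∞) (hw : ∀ y, ∑ i ∈ I, w i y ≤ c) (t : ℕ)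
    (h : Transcript n) :
    ∑ i ∈ I, queryCost A ρ (w i) t h ≤ c * queryCost A ρ (fun _ => 1) t h := by
  induction t generalizing h with
  | zero => simp [queryCost]
  | succ t ih =>
    simp only [queryCost]
    rw [← expect_finset_sum, ← expect_const_mul]
    refine expect_mono _ fun a => ?_
    rcases a with y | R
    · simp only [Sum.elim_inl, Finset.sum_add_distrib, ← expect_finset_sum, mul_add, mul_one,
        ← expect_const_mul]
      exact add_le_add (hw y) (expect_mono _ fun b => ih _)
    · simp

lemma queryCost_le (A : Algorithm n) (ρ : Fin n → PMF Bool) (w : Fin n → ℝ≥0∞) (c : ℝ≥0∞)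
    (hw : ∀ y, w y ≤ c) (t : ℕ) (h : Transcript n) : queryCost A ρ w t h ≤ t * c := by
  induction t generalizing h with
  | zero => simp [queryCost]
  | succ t ih =>
    refine expect_le_const _ fun a => ?_
    rcases a with y | R
    · rw [Nat.cast_succ, add_mul, one_mul, add_comm (_ * c)]
      exact add_le_add (hw y) (expect_le_const _ fun b => ih _)
    · simp

lemma expectedQueries_le_maxQueries (A : Algorithm n) (S : Multiset (Fin n)) (hS : S ≠ 0) :
    expectedQueries A S hS ≤ maxQueries A S hS := by
  refine ENNReal.tsum_le_of_sum_range_le fun N => ?_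
  have hp : ∀ t, probAtLeast A S hS t ≠ 0 → (t : ℝ≥0∞) ≤ maxQueries A S hS := fun t ht =>
    le_iSup₂ (f := fun (t : ℕ) (_ : probAtLeast A S hS t ≠ 0) => (t : ℝ≥0∞)) t ht
  induction N with
  | zero => simp
  | succ N ih =>
    by_cases h : probAtLeast A S hS (N + 1) = 0
    · simpa [Finset.sum_range_succ, h] using ih
    · refine le_trans ?_ (hp _ h)
      calc _ ≤ ∑ t ∈ Finset.range (N + 1), (1 : ℝ≥0∞) :=
            Finset.sum_le_sum fun t _ => probAtLeast_le_one A S hS _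
        _ = _ := by simp

lemma expectedComplexity_le_worstCaseComplexity (n k : ℕ) (δ : ℝ) :
    expectedComplexity n k δ ≤ worstCaseComplexity n k δ :=
  iInf₂_mono fun A _ => iSup_mono fun S => iSup₂_mono fun hS _ =>
    expectedQueries_le_maxQueries A S hS

/-! ### Change of measure between two answer laws. -/

section changeOfMeasure

variable {n : ℕ}

/-- The inequality is affine in the three values, so it can be averaged over the internal randomness
of the algorithm; the common bound `B` ensures summability. -/
lemma expect_toReal_le {α : Type*} (p : PMF α) {f g u : α → ℝ≥0∞} {B : ℝ≥0∞} (hB : B ≠ ∞)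
    (hf : ∀ a, f a ≤ B) (hg : ∀ a, g a ≤ B) (hu : ∀ a, u a ≤ B) {l c s L : ℝ}
    (h : ∀ a, l * (f a).toReal + c ≤ (g a).toReal + s * (1 + L * (u a).toReal)) :
    l * (expect p f).toReal + c ≤ (expect p g).toReal + s * (1 + L * (expect p u).toReal) := by
  have h1 : HasSum (fun a => (p a).toReal) 1 := by
    simpa [expect] using hasSum_expect p (f := fun _ => 1) ENNReal.one_ne_top fun _ => le_rfl
  have hf' := ((hasSum_expect p hB hf).mul_left l).add (h1.mul_right c)
  have hg' := (hasSum_expect p hB hg).add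
    (((h1.add ((hasSum_expect p hB hu).mul_left L))).mul_left s)
  rw [one_mul] at hf'
  refine hasSum_le (fun a => ?_) hf' hg'
  have := mul_le_mul_of_nonneg_left (h a) (ENNReal.toReal_nonneg (a := p a))
  linarith

lemma expect_bool_toReal (p : PMF Bool) {f : Bool → ℝ≥0∞} (hf : ∀ b, f b ≠ ∞) :
    (expect p f).toReal =
      (p true).toReal * (f true).toReal + (p false).toReal * (f false).toReal := by
  rw [expect_bool, ENNReal.toReal_add, ENNReal.toReal_mul, ENNReal.toReal_mul]
  · exact ENNReal.mul_ne_top (p.apply_ne_top _) (hf _)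
  · exact ENNReal.mul_ne_top (p.apply_ne_top _) (hf _)

/-- The Kullback–Leibler divergence of two laws of an answer. -/
def klBool (p q : PMF Bool) : ℝ :=
  (p true).toReal * Real.log ((p true).toReal / (q true).toReal) +
    (p false).toReal * Real.log ((p false).toReal / (q false).toReal)

lemma toReal_add_toReal_bool (p : PMF Bool) : (p true).toReal + (p false).toReal = 1 := by
  have := expect_bool_toReal p (f := fun _ => 1) (by simp)
  rw [expect_const] at this
  simpa using this.symm

/-- A linearized form of the Donsker–Varadhan inequality for the event that the output is `R`,
together with the chain rule for the Kullback–Leibler divergence. -/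
theorem change_of_measure (A : Algorithm n) (ρ σ : Fin n → PMF Bool) (R : Multiset (Fin n))
    (w : Fin n → ℝ≥0∞) (hw : ∀ y, w y ≠ ∞) (hac : ∀ y b, ρ y b ≠ 0 → σ y b ≠ 0)
    (hkl : ∀ y, klBool (ρ y) (σ y) ≤ (w y).toReal) {L : ℝ} (hL : 0 ≤ L) (t : ℕ)
    (h : Transcript n) {s : ℝ} (hs : 0 < s) :
    Real.log (1 + L) * (runValue A ρ (hasOutput R) t h).toReal + (1 + Real.log s) ≤
      (queryCost A ρ w t h).toReal + s * (1 + L * (runValue A σ (hasOutput R) t h).toReal) := by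
  have hW : ∀ y, w y ≤ ∑ y, w y := fun y => Finset.single_le_sum (fun _ _ => zero_le) (by simp)
  have hWt : ∑ y, w y ≠ ∞ := ENNReal.sum_ne_top.2 fun y _ => hw y
  have hQ : ∀ t h, queryCost A ρ w t h ≠ ∞ := fun t h =>
    ((queryCost_le A ρ w _ hW t h).trans_lt
      (ENNReal.mul_lt_top (ENNReal.natCast_lt_top t) hWt.lt_top)).ne
  have hV : ∀ ρ' t h, runValue A ρ' (hasOutput R) t h ≠ ∞ := fun ρ' t h =>
    ((runValue_hasOutput_le_one A ρ' R t h).trans_lt ENNReal.one_lt_top).ne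
  induction t generalizing h s with
  | zero =>
    simp only [runValue_zero, hasOutput_inl, queryCost]
    have := Real.log_le_sub_one_of_pos hs
    simp
    linarith
  | succ t ih =>
    rw [runValue_succ, runValue_succ, queryCost]
    have hB : (1 + (t + 1) * ∑ y, w y : ℝ≥0∞) ≠ ∞ := by
      finiteness
    have hone : (1 : ℝ≥0∞) ≤ 1 + (t + 1) * ∑ y, w y := le_self_add
    refine expect_toReal_le (A h) hB ?_ ?_ ?_ ?_
    · rintro (y | R')
      · exact (expect_le_const _ fun b => runValue_hasOutput_le_one A ρ R t _).trans hone
      · exact (hasOutput_le_one R _).trans hone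
    · rintro (y | R')
      · refine le_trans ?_ le_add_self
        rw [add_mul, one_mul, add_comm (_ * _)]
        exact add_le_add (hW y) (expect_le_const _ fun b => queryCost_le A ρ w _ hW t _)
      · simp
    · rintro (y | R')
      · exact (expect_le_const _ fun b => runValue_hasOutput_le_one A σ R t _).trans hone
      · exact (hasOutput_le_one R _).trans hone
    · rintro (y | R')
      · simp only [Sum.elim_inl]
        rw [ENNReal.toReal_add (hw y) (by
            rw [expect_bool]
            exact ENNReal.add_ne_top.2 ⟨ENNReal.mul_ne_top ((ρ y).apply_ne_top _) (hQ _ _),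
              ENNReal.mul_ne_top ((ρ y).apply_ne_top _) (hQ _ _)⟩),
          expect_bool_toReal _ fun b => hV ρ t _, expect_bool_toReal _ fun b => hV σ t _,
          expect_bool_toReal _ fun b => hQ t _]
        have key : ∀ b, (ρ y b).toReal * (Real.log (1 + L) *
            (runValue A ρ (hasOutput R) t ((y, b) :: h)).toReal + (1 + Real.log s)) -
            (ρ y b).toReal * Real.log ((ρ y b).toReal / (σ y b).toReal) ≤
            (ρ y b).toReal * (queryCost A ρ w t ((y, b) :: h)).toReal +
            s * (σ y b).toReal *
              (1 + L * (runValue A σ (hasOutput R) t ((y, b) :: h)).toReal) := by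
          intro b
          by_cases hb : ρ y b = 0
          · simp only [hb, ENNReal.toReal_zero, zero_mul, sub_zero, zero_add]
            positivity
          · have hp : 0 < (ρ y b).toReal := ENNReal.toReal_pos hb ((ρ y).apply_ne_top b)
            have hq : 0 < (σ y b).toReal :=
              ENNReal.toReal_pos (hac y b hb) ((σ y).apply_ne_top b)
            -- The parameter `s` is rescaled by the likelihood ratio of the answer: the `σ`-term
            -- then averages correctly, and `log s` yields the divergence of this query.
            have := mul_le_mul_of_nonneg_left
              (ih ((y, b) :: h) (s := s * ((σ y b).toReal / (ρ y b).toReal)) (by positivity)) hp.le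
            rw [Real.log_mul hs.ne' (by positivity), ← inv_div, Real.log_inv, mul_add,
              mul_add (ρ y b).toReal (queryCost _ _ _ _ _).toReal] at this
            have e : ∀ x : ℝ, (ρ y b).toReal * (s * ((ρ y b).toReal / (σ y b).toReal)⁻¹ * x) =
                s * (σ y b).toReal * x := by
              intro x; field_simp
            rw [e] at this
            linarith
        have kt := key true
        have kf := key false
        have h1 := toReal_add_toReal_bool (ρ y)
        have h2 := toReal_add_toReal_bool (σ y)
        have h3 := hkl y
        unfold klBool at h3
        have e1 : (ρ y false).toReal = 1 - (ρ y true).toReal := by linarith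
        have e2 : (σ y false).toReal = 1 - (σ y true).toReal := by linarith
        rw [e1, e2] at h3
        rw [e1, e2] at kf
        rw [e1, e2]
        linarith
      · simp only [Sum.elim_inr, ENNReal.toReal_zero, zero_add]
        by_cases hR : R' = R
        · subst hR
          have := Real.log_le_sub_one_of_pos (x := s * (1 + L)) (by positivity)
          rw [Real.log_mul hs.ne' (by positivity)] at this
          simp only [hasOutput_self, ENNReal.toReal_one, mul_one]
          linarith
        · have := Real.log_le_sub_one_of_pos hs
          simp only [hasOutput_of_ne hR, ENNReal.toReal_zero, mul_zero]
          linarith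

/-- The change of measure for an algorithm that need not stop within a bounded time. -/
theorem change_of_measure_successProb (A : Algorithm n) {S : Multiset (Fin n)} (hS : S ≠ 0)
    (σ : Fin n → PMF Bool) (w : Fin n → ℝ≥0∞) (hw : ∀ y, w y ≠ ∞)
    (hac : ∀ y b, answer S hS y b ≠ 0 → σ y b ≠ 0)
    (hkl : ∀ y, klBool (answer S hS y) (σ y) ≤ (w y).toReal) {L : ℝ} (hL : 0 ≤ L)
    (hsucc : ENNReal.ofReal (3 / 4) < successProb A S hS) :
    ENNReal.ofReal (Real.log (1 + L) * (3 / 4) + (1 - Real.log 2)) ≤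
      (⨆ t, queryCost A (answer S hS) w t []) +
        ENNReal.ofReal (1 / 2) * (1 + ENNReal.ofReal L * ⨆ t, runValue A σ (hasOutput S) t []) := by
  rw [successProb_eq] at hsucc
  obtain ⟨t, ht⟩ := lt_iSup_iff.1 hsucc
  have hV : ∀ ρ', runValue A ρ' (hasOutput S) t [] ≠ ∞ := fun ρ' =>
    ((runValue_hasOutput_le_one A ρ' S t []).trans_lt ENNReal.one_lt_top).ne
  have hQ : queryCost A (answer S hS) w t [] ≠ ∞ := by
    have hW : ∀ y, w y ≤ ∑ y, w y := fun y => Finset.single_le_sum (fun _ _ => zero_le) (by simp)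
    have hWt : ∑ y, w y ≠ ∞ := ENNReal.sum_ne_top.2 fun y _ => hw y
    exact ((queryCost_le A _ w _ hW t []).trans_lt
      (ENNReal.mul_lt_top (ENNReal.natCast_lt_top t) hWt.lt_top)).ne
  -- The best `s` is the inverse of `1 + L * P`, with `P` the probability of output `S` under `σ`;
  -- in both applications `L * P` is at most 1 on average, whence `1 / 2`.
  have key := change_of_measure A (answer S hS) σ S w hw hac hkl hL t [] (s := 1 / 2) (by norm_num)
  have h34 : (3 / 4 : ℝ) ≤ (runValue A (answer S hS) (hasOutput S) t []).toReal :=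
    (ENNReal.ofReal_le_iff_le_toReal (hV _)).1 ht.le
  have hl : Real.log (1 / 2) = - Real.log 2 := by rw [one_div, Real.log_inv]
  have hlog : 0 ≤ Real.log (1 + L) := Real.log_nonneg (by linarith)
  calc _ ≤ ENNReal.ofReal ((queryCost A (answer S hS) w t []).toReal +
            1 / 2 * (1 + L * (runValue A σ (hasOutput S) t []).toReal)) := by
        apply ENNReal.ofReal_le_ofReal
        have := mul_le_mul_of_nonneg_left h34 hlog
        rw [hl] at key
        linarith
    _ = queryCost A (answer S hS) w t [] + ENNReal.ofReal (1 / 2) *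
          (1 + ENNReal.ofReal L * runValue A σ (hasOutput S) t []) := by
        rw [ENNReal.ofReal_add (by positivity) (by positivity), ENNReal.ofReal_toReal hQ,
          ENNReal.ofReal_mul (by norm_num), ENNReal.ofReal_add (by norm_num) (by positivity),
          ENNReal.ofReal_mul hL, ENNReal.ofReal_toReal (hV _), ENNReal.ofReal_one]
    _ ≤ _ := by
        gcongr
        · exact le_iSup (fun t => queryCost A (answer S hS) w t []) t
        · exact le_iSup (fun t => runValue A σ (hasOutput S) t []) t

end changeOfMeasure

/-! ### Answer probabilities as counts. -/

/-- The number of elements of `S` that are at most `y`. -/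
def countLE {n : ℕ} (S : Multiset (Fin n)) (y : Fin n) : ℕ := (S.filter (· ≤ y)).card

section answer

variable {n : ℕ}

lemma countLE_le_card (S : Multiset (Fin n)) (y : Fin n) : countLE S y ≤ S.card :=
  Multiset.card_le_card (Multiset.filter_le _ _)

lemma countLE_add (S S' : Multiset (Fin n)) (y : Fin n) :
    countLE (S + S') y = countLE S y + countLE S' y := by
  simp [countLE]

lemma countLE_map {ι : Type*} (s : Multiset ι) (f : ι → Fin n) (y : Fin n) :
    countLE (s.map f) y = (s.filter fun i => f i ≤ y).card := by
  simp [countLE, Multiset.filter_map]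

lemma countLE_replicate (a : ℕ) (x y : Fin n) :
    countLE (Multiset.replicate a x) y = if x ≤ y then a else 0 := by
  unfold countLE
  split_ifs with h
  · rw [Multiset.filter_eq_self.2, Multiset.card_replicate]
    intro z hz
    rwa [Multiset.eq_of_mem_replicate hz]
  · rw [Multiset.filter_eq_nil.2, Multiset.card_zero]
    intro z hz
    rwa [Multiset.eq_of_mem_replicate hz]

lemma answer_true (S : Multiset (Fin n)) (hS : S ≠ 0) (y : Fin n) :
    answer S hS y true = (countLE S y : ℝ≥0∞) / S.card := by
  have : answer S hS y true = ∑ x, if x ≤ y then (S.count x : ℝ≥0∞) / S.card else 0 := by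
    rw [answer, PMF.map_apply, tsum_fintype]
    refine Finset.sum_congr rfl fun x _ => ?_
    by_cases h : x ≤ y
    · simp only [h, PMF.ofMultiset_apply, decide_true, if_true]
      congr!
    · simp [h]
  have hc : countLE S y = ∑ x with x ≤ y, S.count x := by
    rw [countLE, ← Multiset.sum_count_eq_card (s := Finset.univ.filter (· ≤ y)) (by simp)]
    exact Finset.sum_congr rfl fun x hx => Multiset.count_filter_of_pos (by simpa using hx)
  rw [this, hc, ← Finset.sum_filter]
  simp only [div_eq_mul_inv, Nat.cast_sum, Finset.sum_mul]

lemma answer_true_toReal (S : Multiset (Fin n)) (hS : S ≠ 0) (y : Fin n) :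
    (answer S hS y true).toReal = countLE S y / S.card := by
  simp [answer_true]

lemma answer_false_toReal (S : Multiset (Fin n)) (hS : S ≠ 0) (y : Fin n) :
    (answer S hS y false).toReal = 1 - countLE S y / S.card := by
  rw [← answer_true_toReal S hS, eq_sub_iff_add_eq, add_comm, toReal_add_toReal_bool]

lemma answer_congr {S S' : Multiset (Fin n)} (hS : S ≠ 0) (hS' : S' ≠ 0) (y : Fin n)
    (hc : S.card = S'.card) (h : countLE S y = countLE S' y) :
    answer S hS y = answer S' hS' y := by
  ext b
  rw [← ENNReal.toReal_eq_toReal_iff' ((answer S hS y).apply_ne_top _)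
    ((answer S' hS' y).apply_ne_top _)]
  cases b
  · rw [answer_false_toReal, answer_false_toReal, hc, h]
  · rw [answer_true_toReal, answer_true_toReal, hc, h]

end answer

/-! ### Divergence of a single answer. -/

section kl

lemma klBool_self (p : PMF Bool) : klBool p p = 0 := by
  simp [klBool]

lemma mul_log_div_le {p q : ℝ} (hp : 0 ≤ p) (hq : 0 < q) :
    p * Real.log (p / q) ≤ p * (p / q - 1) := by
  rcases hp.eq_or_lt with h | h
  · simp [← h]
  · exact mul_le_mul_of_nonneg_left (Real.log_le_sub_one_of_pos (by positivity)) hp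

/-- The bound `log z ≤ z - 1` replaces the divergence by the chi-square distance `(a - b) ^ 2 / (b *
(1 - b))`, and `b * (1 - b) ≥ 1 / 7` on this range. -/
lemma klBool_le (p q : PMF Bool) (h1 : 1 / 5 ≤ (q true).toReal) (h2 : (q true).toReal ≤ 2 / 3) :
    klBool p q ≤ 7 * ((p true).toReal - (q true).toReal) ^ 2 := by
  have hp := toReal_add_toReal_bool p
  have hq := toReal_add_toReal_bool q
  have hp0 : 0 ≤ (p true).toReal := ENNReal.toReal_nonneg
  have hp1 : 0 ≤ (p false).toReal := ENNReal.toReal_nonneg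
  unfold klBool
  generalize (p true).toReal = a at *
  generalize (q true).toReal = b at *
  have e1 : (p false).toReal = 1 - a := by linarith
  have e2 : (q false).toReal = 1 - b := by linarith
  rw [e1] at hp1
  rw [e1, e2]
  have k1 := mul_log_div_le hp0 (show 0 < b by linarith)
  have k2 := mul_log_div_le hp1 (show 0 < 1 - b by linarith)
  have e : a * (a / b - 1) + (1 - a) * ((1 - a) / (1 - b) - 1) = (a - b) ^ 2 / (b * (1 - b)) := by
    have : b ≠ 0 := by linarith
    have : 1 - b ≠ 0 := by linarith
    field_simp
    ring
  have hb : 1 / 7 ≤ b * (1 - b) := by nlinarith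
  have : (a - b) ^ 2 / (b * (1 - b)) ≤ 7 * (a - b) ^ 2 := by
    rw [div_le_iff₀ (by linarith)]
    nlinarith [sq_nonneg (a - b)]
  linarith

/-- The law of a fair coin. -/
def fairCoin : PMF Bool := PMF.uniformOfFintype Bool

lemma klBool_fairCoin_le (p : PMF Bool) : klBool p fairCoin ≤ Real.log 2 := by
  have hp := toReal_add_toReal_bool p
  have h : ∀ b, (p b).toReal * Real.log ((p b).toReal / (fairCoin b).toReal) ≤
      (p b).toReal * Real.log 2 := by
    intro b
    have hp1 : (p b).toReal ≤ 1 := by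
      simpa using ENNReal.toReal_mono ENNReal.one_ne_top (p.coe_le_one b)
    have : (p b).toReal / (fairCoin b).toReal = (p b).toReal * 2 := by
      simp [fairCoin, PMF.uniformOfFintype_apply]
    rw [this]
    rcases (ENNReal.toReal_nonneg (a := p b)).eq_or_lt with h0 | h0
    · simp [← h0]
    · exact mul_le_mul_of_nonneg_left (Real.log_le_log (by positivity) (by linarith)) h0.le
  have ht := h true
  have hf := h false
  unfold klBool
  calc _ ≤ ((p true).toReal + (p false).toReal) * Real.log 2 := by linarith
    _ = Real.log 2 := by rw [hp, one_mul]

end kl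

/-! ### Distinct outputs are disjoint events. -/

section outputs

variable {n : ℕ}

lemma runValue_hasOutput_mono (A : Algorithm n) (ρ : Fin n → PMF Bool) (R : Multiset (Fin n)) :
    Monotone fun t => runValue A ρ (hasOutput R) t [] := by
  refine monotone_nat_of_le_succ fun t => ?_
  generalize ([] : Transcript n) = h
  induction t generalizing h with
  | zero => simp [runValue_zero, hasOutput_inl]
  | succ t ih =>
    rw [runValue_succ, runValue_succ A ρ _ (t + 1)]
    refine expect_mono _ fun a => ?_
    rcases a with y | R'
    · exact expect_mono _ fun b => ih _
    · exact le_rfl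

lemma sum_iSup_runValue_hasOutput_le_one (A : Algorithm n) (ρ : Fin n → PMF Bool)
    (D : Finset (Multiset (Fin n))) :
    ∑ R ∈ D, ⨆ t, runValue A ρ (hasOutput R) t [] ≤ 1 := by
  rw [ENNReal.finsetSum_iSup_of_monotone fun R => runValue_hasOutput_mono A ρ R]
  refine iSup_le fun t => ?_
  simp only [runValue]
  rw [← expect_finset_sum]
  refine expect_le_const _ fun s => ?_
  classical
  rcases s with h | R
  · simp [hasOutput]
  · simp only [hasOutput, Sum.inr.injEq, Finset.sum_ite_eq]
    split_ifs <;> simp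

end outputs

/-! ### The counting bound `log n`. -/

section counting

variable {n : ℕ}

/-- The information-theoretic lower bound, for the multisets with a single distinct element. -/
lemma log_le_of_determines {k : ℕ} (hk : 1 ≤ k) {δ : ℝ} (hδ : δ < 1 / 4) (A : Algorithm n)
    (hA : Determines A k δ) (hn : 1 ≤ n) {B : ℝ≥0∞}
    (hB : ∀ (S : Multiset (Fin n)) (hS : S ≠ 0), S.card = k → expectedQueries A S hS ≤ B) :
    ENNReal.ofReal (3 / 4 * Real.log (1 + n) - Real.log 2) ≤ B := by
  have hne : ∀ x : Fin n, Multiset.replicate k x ≠ 0 := fun x h => by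
    have := congrArg Multiset.card h
    simp at this
    omega
  have hl2 : 0 ≤ Real.log 2 := Real.log_nonneg (by norm_num)
  have hl2' : Real.log 2 ≤ 1 := by linarith [Real.log_two_lt_d9]
  have key : ∀ x : Fin n, ENNReal.ofReal (Real.log (1 + n) * (3 / 4) + (1 - Real.log 2)) ≤ B +
      ENNReal.ofReal (1 / 2) * (1 + ENNReal.ofReal n *
        ⨆ t, runValue A (fun _ => fairCoin) (hasOutput (Multiset.replicate k x)) t []) := by
    intro x
    refine (change_of_measure_successProb A (hne x) (fun _ => fairCoin)
      (fun _ => ENNReal.ofReal (Real.log 2)) (fun _ => ENNReal.ofReal_ne_top) ?_ ?_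
      (Nat.cast_nonneg n) ?_).trans ?_
    · intro y b _
      simp [fairCoin]
    · intro y
      rw [ENNReal.toReal_ofReal hl2]
      exact klBool_fairCoin_le _
    · refine lt_of_lt_of_le ?_ (hA _ (hne x) (by simp))
      exact (ENNReal.ofReal_lt_ofReal_iff (by linarith)).2 (by linarith)
    · gcongr
      refine iSup_le fun t => ?_
      have := sum_queryCost_le (Finset.univ : Finset Unit) A (answer _ (hne x))
        (fun _ _ => ENNReal.ofReal (Real.log 2)) 1 (fun y => by simpa using hl2') t []
      simp only [Finset.univ_unique, Finset.sum_const, Finset.card_singleton, one_smul,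
        one_mul] at this
      exact this.trans ((queryCost_one_le_expectedQueries A _ (hne x) t).trans (hB _ _ (by simp)))
  have hsum := Finset.sum_le_sum fun x (_ : x ∈ Finset.univ) => key x
  have hq : ∑ x : Fin n,
      ⨆ t, runValue A (fun _ => fairCoin) (hasOutput (Multiset.replicate k x)) t [] ≤ 1 := by
    have hinj : Function.Injective fun x : Fin n => Multiset.replicate k x := fun x y h =>
      (Multiset.replicate_right_injective (by omega)) h
    simpa using sum_iSup_runValue_hasOutput_le_one A (fun _ => fairCoin)
      (Finset.univ.map ⟨_, hinj⟩)
  rw [Finset.sum_const, Finset.sum_add_distrib, ← Finset.mul_sum, Finset.sum_add_distrib,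
    ← Finset.mul_sum] at hsum
  simp only [Finset.sum_const, Finset.card_univ, Fintype.card_fin, nsmul_eq_mul, mul_one,
    ENNReal.ofReal_natCast] at hsum
  have h3 : (n : ℝ≥0∞) * ENNReal.ofReal (Real.log (1 + n) * (3 / 4) + (1 - Real.log 2)) ≤
      n * (B + 1) := by
    refine hsum.trans ?_
    rw [mul_add (n : ℝ≥0∞) B, mul_one]
    gcongr
    calc _ ≤ ENNReal.ofReal (1 / 2) * (n + n * 1) := by gcongr
      _ = ENNReal.ofReal (1 / 2 * (n + n)) := by
        rw [ENNReal.ofReal_mul (by norm_num), ENNReal.ofReal_add (by positivity) (by positivity)]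
        simp
      _ = n := by rw [← ENNReal.ofReal_natCast]; congr 1; ring
  have h4 := (ENNReal.mul_le_mul_iff_right (by simp; omega) (ENNReal.natCast_ne_top n)).1 h3
  rw [show 3 / 4 * Real.log (1 + n) - Real.log 2 =
    Real.log (1 + n) * (3 / 4) + (1 - Real.log 2) - 1 by ring, ENNReal.ofReal_sub _ zero_le_one,
    ENNReal.ofReal_one]
  exact tsub_le_iff_right.2 h4

end counting

/-! ### The hard instances. -/

section spread

variable {n M m : ℕ}

/-- The `v`-th position of the `i`-th of `M` consecutive blocks of length `m`. -/
def blockPos (hMm : M * m ≤ n) (i : Fin M) (v : Fin m) : Fin n :=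
  Fin.castLE hMm (finProdFinEquiv (i, v))

lemma blockPos_val (hMm : M * m ≤ n) (i : Fin M) (v : Fin m) :
    (blockPos hMm i v : ℕ) = v + m * i := by
  simp [blockPos]

/-- The right side does not involve `v`: a query outside block `i` learns nothing about the position
inside it. -/
lemma blockPos_le_iff_of_ne (hMm : M * m ≤ n) (i : Fin M) (v : Fin m) (q : Fin n)
    (h : (q : ℕ) / m ≠ i) : blockPos hMm i v ≤ q ↔ (i : ℕ) < q / m := by
  rw [Fin.le_def, blockPos_val]
  have hm : 0 < m := v.pos
  constructor
  · intro h'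
    refine lt_of_le_of_ne ?_ (Ne.symm h)
    rw [Nat.le_div_iff_mul_le hm]
    nlinarith
  · intro h'
    have h2 : ((i : ℕ) + 1) * m ≤ q := (Nat.le_div_iff_mul_le hm).1 h'
    have := v.isLt
    nlinarith

/-- The multiset with `a` copies of the smallest integer, `b` copies of the largest one, and one
element in each block, at the position given by `x`. -/
def spread (hn : 0 < n) (hMm : M * m ≤ n) (a b : ℕ) (x : Fin M → Fin m) : Multiset (Fin n) :=
  Multiset.replicate a ⟨0, hn⟩ + Finset.univ.val.map (fun i => blockPos hMm i (x i)) +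
    Multiset.replicate b ⟨n - 1, by omega⟩

variable (hn : 0 < n) (hMm : M * m ≤ n) (a b : ℕ)

lemma card_spread (x : Fin M → Fin m) : (spread hn hMm a b x).card = a + M + b := by
  simp [spread]

lemma spread_injective : Function.Injective (spread hn hMm a b) := by
  intro x x' h
  simp only [spread, add_left_inj, add_right_inj] at h
  funext i
  have hi : blockPos hMm i (x i) ∈ Finset.univ.val.map fun i => blockPos hMm i (x' i) := by
    rw [← h]
    exact Multiset.mem_map_of_mem (fun i => blockPos hMm i (x i)) (Finset.mem_univ i)
  obtain ⟨j, -, hj⟩ := Multiset.mem_map.1 hi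
  have := finProdFinEquiv.injective (Fin.castLE_injective hMm hj)
  simp only [Prod.mk.injEq] at this
  obtain ⟨rfl, h2⟩ := this
  exact h2.symm

lemma countLE_spread (x : Fin M → Fin m) (q : Fin n) : countLE (spread hn hMm a b x) q =
    a + (∑ i, if blockPos hMm i (x i) ≤ q then 1 else 0) + if (q : ℕ) = n - 1 then b else 0 := by
  rw [spread, countLE_add, countLE_add, countLE_replicate, countLE_replicate, countLE_map]
  congr 1
  · congr 1
    exact Finset.card_filter (fun i => blockPos hMm i (x i) ≤ q) Finset.univ
  · congr 1
    rw [Fin.le_def, eq_iff_iff]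
    have := q.isLt
    simp only
    omega

lemma countLE_spread_last (x : Fin M → Fin m) (q : Fin n) (hq : (q : ℕ) = n - 1) :
    countLE (spread hn hMm a b x) q = a + M + b := by
  rw [countLE_spread, if_pos hq]
  have : ∀ i, blockPos hMm i (x i) ≤ q := fun i => by
    rw [Fin.le_def]
    have := (blockPos hMm i (x i)).isLt
    omega
  simp [this]

lemma countLE_spread_le (x : Fin M → Fin m) (q : Fin n) (hq : (q : ℕ) ≠ n - 1) :
    countLE (spread hn hMm a b x) q ≤ a + M := by
  rw [countLE_spread, if_neg hq, add_zero, ← Finset.card_filter]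
  have := Finset.card_filter_le (Finset.univ : Finset (Fin M))
    fun i => blockPos hMm i (x i) ≤ q
  simp only [Finset.card_univ, Fintype.card_fin] at this
  omega

lemma le_countLE_spread (x : Fin M → Fin m) (q : Fin n) :
    a ≤ countLE (spread hn hMm a b x) q := by
  rw [countLE_spread]
  omega

lemma countLE_spread_update (x : Fin M → Fin m) (i : Fin M) (y : Fin m) (q : Fin n) :
    countLE (spread hn hMm a b (Function.update x i y)) q +
        (if blockPos hMm i (x i) ≤ q then 1 else 0) =
      countLE (spread hn hMm a b x) q + if blockPos hMm i y ≤ q then 1 else 0 := by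
  rw [countLE_spread, countLE_spread]
  rw [← Finset.add_sum_erase _ _ (Finset.mem_univ i), ← Finset.add_sum_erase _ (fun j =>
    if blockPos hMm j (x j) ≤ q then 1 else 0) (Finset.mem_univ i)]
  have : ∑ j ∈ Finset.univ.erase i,
      (if blockPos hMm j (Function.update x i y j) ≤ q then 1 else 0) =
      ∑ j ∈ Finset.univ.erase i, if blockPos hMm j (x j) ≤ q then 1 else 0 :=
    Finset.sum_congr rfl fun j hj => by rw [Function.update_of_ne (Finset.ne_of_mem_erase hj)]
  rw [this, Function.update_self]
  omega

lemma countLE_spread_update_of_ne (x : Fin M → Fin m) (i : Fin M) (y : Fin m) (q : Fin n)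
    (h : (q : ℕ) / m ≠ i) :
    countLE (spread hn hMm a b (Function.update x i y)) q = countLE (spread hn hMm a b x) q := by
  have := countLE_spread_update hn hMm a b x i y q
  simp only [blockPos_le_iff_of_ne hMm i _ q h] at this
  omega

lemma klBool_answer_spread_le {k : ℕ} (hk : a + M + b = k) (hk0 : 0 < k) (ha : k ≤ 5 * a)
    (hb : 3 * (a + M) ≤ 2 * k) (x : Fin M → Fin m) (i : Fin M) (y : Fin m)
    (h1 : spread hn hMm a b x ≠ 0) (h2 : spread hn hMm a b (Function.update x i y) ≠ 0)
    (q : Fin n) :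
    (∀ c, answer _ h1 q c ≠ 0 → answer _ h2 q c ≠ 0) ∧
      klBool (answer _ h1 q) (answer _ h2 q) ≤ if (q : ℕ) / m = i then 7 / (k : ℝ) ^ 2 else 0 := by
  by_cases heq : countLE (spread hn hMm a b (Function.update x i y)) q =
      countLE (spread hn hMm a b x) q
  · rw [answer_congr h1 h2 q (by rw [card_spread, card_spread]) heq.symm, klBool_self]
    exact ⟨fun _ h => h, by split_ifs <;> positivity⟩
  · have hq : (q : ℕ) / m = i := by
      by_contra hne
      exact heq (countLE_spread_update_of_ne hn hMm a b x i y q hne)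
    -- At the largest integer the answer is certain, so the probabilities agree there; every other
    -- query misses the `b` upper copies, which keeps its probability at most 2/3.
    have hlast : (q : ℕ) ≠ n - 1 := fun hl =>
      heq (by rw [countLE_spread_last _ _ _ _ _ _ hl, countLE_spread_last _ _ _ _ _ _ hl])
    rw [if_pos hq]
    have hu := countLE_spread_update hn hMm a b x i y q
    have hle := countLE_spread_le hn hMm a b (Function.update x i y) q hlast
    have hge := le_countLE_spread hn hMm a b (Function.update x i y) q
    have ht1 := answer_true_toReal _ h1 q
    have ht2 := answer_true_toReal _ h2 q
    have hf2 := answer_false_toReal _ h2 q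
    rw [card_spread, hk] at ht1 ht2 hf2
    generalize countLE (spread hn hMm a b (Function.update x i y)) q = v at *
    generalize countLE (spread hn hMm a b x) q = u at *
    have hkR : (0 : ℝ) < k := by exact_mod_cast hk0
    have hv1 : (1 / 5 : ℝ) ≤ v / k := by
      rw [div_le_div_iff₀ (by norm_num) hkR]
      have : k ≤ 5 * v := by omega
      have : (k : ℝ) ≤ 5 * v := by exact_mod_cast this
      linarith
    have hv2 : (v / k : ℝ) ≤ 2 / 3 := by
      rw [div_le_div_iff₀ hkR (by norm_num)]
      have : v * 3 ≤ 2 * k := by omega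
      exact_mod_cast this
    constructor
    · intro c _ h0
      cases c
      · rw [h0, ENNReal.toReal_zero] at hf2
        linarith
      · rw [h0, ENNReal.toReal_zero] at ht2
        linarith
    · refine (klBool_le _ _ (by rw [ht2]; exact hv1) (by rw [ht2]; exact hv2)).trans ?_
      rw [ht1, ht2, ← sub_div, div_pow, ← mul_div_assoc]
      have huv : ((u : ℝ) - v) ^ 2 ≤ 1 := by
        have h3 : u ≤ v + 1 := by split_ifs at hu <;> omega
        have h4 : v ≤ u + 1 := by split_ifs at hu <;> omega
        have h3' : (u : ℝ) ≤ v + 1 := by exact_mod_cast h3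
        have h4' : (v : ℝ) ≤ u + 1 := by exact_mod_cast h4
        rw [sq_le_one_iff_abs_le_one, abs_le]
        constructor <;> linarith
      gcongr
      linarith

end spread

/-! ### Averaging over the hard instances. -/

lemma queryCost_mono {n : ℕ} (A : Algorithm n) (ρ : Fin n → PMF Bool) (w : Fin n → ℝ≥0∞) :
    Monotone fun t => queryCost A ρ w t [] := by
  refine monotone_nat_of_le_succ fun t => ?_
  generalize ([] : Transcript n) = h
  induction t generalizing h with
  | zero => simp [queryCost]
  | succ t ih =>
    rw [queryCost, queryCost]
    refine expect_mono _ fun a => ?_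
    rcases a with y | R'
    · exact add_le_add_right (expect_mono _ fun b => ih _) _
    · exact le_rfl

/-- Exchanging an instance with its neighbour is an involution on triples `(x, i, y)`. It turns "law
of the neighbour, output of `x`" into "law of `x`, output of the neighbour", which can be summed
over neighbours by disjointness. -/
lemma sum_update_comm {M m : ℕ} (f : (Fin M → Fin m) → (Fin M → Fin m) → ℝ≥0∞) :
    ∑ x : Fin M → Fin m, ∑ i, ∑ y with y ≠ x i, f (Function.update x i y) x =
      ∑ x : Fin M → Fin m, ∑ i, ∑ y with y ≠ x i, f x (Function.update x i y) := by
  have h : ∀ g : (Fin M → Fin m) × Fin M × Fin m → ℝ≥0∞,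
      ∑ x : Fin M → Fin m, ∑ i, ∑ y with y ≠ x i, g (x, i, y) =
      ∑ p with p.2.2 ≠ p.1 p.2.1, g p := by
    intro g
    rw [Finset.sum_filter, Fintype.sum_prod_type]
    simp [Fintype.sum_prod_type, Finset.sum_filter]
  rw [h fun p => f (Function.update p.1 p.2.1 p.2.2) p.1,
    h fun p => f p.1 (Function.update p.1 p.2.1 p.2.2)]
  let e : (Fin M → Fin m) × Fin M × Fin m → (Fin M → Fin m) × Fin M × Fin m :=
    fun p => (Function.update p.1 p.2.1 p.2.2, p.2.1, p.1 p.2.1)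
  refine Finset.sum_nbij' e e ?_ ?_ ?_ ?_ ?_
  · rintro ⟨x, i, y⟩ hp
    simpa [e, eq_comm] using hp
  · rintro ⟨x, i, y⟩ hp
    simpa [e, eq_comm] using hp
  · rintro ⟨x, i, y⟩ -
    simp [e]
  · rintro ⟨x, i, y⟩ -
    simp [e]
  · rintro ⟨x, i, y⟩ -
    simp [e]

section blocks

variable {n M m : ℕ}

/-- The neighbours of `x` have distinct outputs, all different from the correct one, which already
takes probability 3/4. -/
lemma sum_runValue_spread_update_le (hn : 0 < n) (hMm : M * m ≤ n) (a b : ℕ) (A : Algorithm n)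
    (x : Fin M → Fin m) (h0 : spread hn hMm a b x ≠ 0)
    (hsucc : ENNReal.ofReal (3 / 4) ≤ successProb A (spread hn hMm a b x) h0) :
    ∑ i, ∑ y with y ≠ x i, ⨆ t, runValue A (answer _ h0)
      (hasOutput (spread hn hMm a b (Function.update x i y))) t [] ≤ ENNReal.ofReal (1 / 4) := by
  classical
  set Q : Multiset (Fin n) → ℝ≥0∞ := fun R => ⨆ t, runValue A (answer _ h0) (hasOutput R) t []
  set E : Finset (Fin M × Fin m) := Finset.univ.filter fun p => p.2 ≠ x p.1
  set g : Fin M × Fin m → Multiset (Fin n) :=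
    fun p => spread hn hMm a b (Function.update x p.1 p.2)
  have hsum : ∑ i, ∑ y with y ≠ x i, Q (g (i, y)) = ∑ p ∈ E, Q (g p) := by
    rw [Finset.sum_filter, Fintype.sum_prod_type]
    simp only [Finset.sum_filter]
  have hinj : Set.InjOn g E := by
    rintro ⟨i, y⟩ hp ⟨i', y'⟩ - h
    have h' := congrFun (spread_injective hn hMm a b h) i
    simp only [Function.update_self] at h'
    have hne : y ≠ x i := by simpa [E] using hp
    by_cases hi : i = i'
    · subst hi
      rw [Function.update_self] at h'
      rw [h']
    · rw [Function.update_of_ne hi] at h'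
      exact absurd h' hne
  have hnot : spread hn hMm a b x ∉ E.image g := by
    intro hmem
    obtain ⟨⟨i, y⟩, hp, h⟩ := Finset.mem_image.1 hmem
    have h' := congrFun (spread_injective hn hMm a b h) i
    simp only [Function.update_self] at h'
    exact (by simpa [E] using hp : y ≠ x i) h'
  have h1 := sum_iSup_runValue_hasOutput_le_one A (answer _ h0)
    (insert (spread hn hMm a b x) (E.image g))
  rw [Finset.sum_insert hnot, Finset.sum_image hinj, ← successProb_eq] at h1
  change ∑ i, ∑ y with y ≠ x i, Q (g (i, y)) ≤ _
  rw [hsum]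
  have h2 := (add_le_add_left hsucc _).trans h1
  have h3 : ENNReal.ofReal (1 / 4) = 1 - ENNReal.ofReal (3 / 4) := by
    rw [← ENNReal.ofReal_one, ← ENNReal.ofReal_sub _ (by norm_num)]
    norm_num
  rw [h3]
  exact ENNReal.le_sub_of_add_le_left ENNReal.ofReal_ne_top h2

/-- The lower bound from `M` disjoint blocks of length `m`, each containing one element whose
position in the block is to be found. -/
lemma blocks_lower_bound {k a b : ℕ} (hn : 0 < n) (hM : 1 ≤ M) (hm : 2 ≤ m) (hMm : M * m ≤ n)
    (hk : a + M + b = k) (ha : k ≤ 5 * a) (hb : 3 * (a + M) ≤ 2 * k) {δ : ℝ} (hδ : δ < 1 / 4)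
    (A : Algorithm n) (hA : Determines A k δ) {B : ℝ≥0∞}
    (hB : ∀ (S : Multiset (Fin n)) (hS : S ≠ 0), S.card = k → expectedQueries A S hS ≤ B) :
    ENNReal.ofReal (M * (3 / 4 * Real.log (1 + 4 * M * (m - 1 : ℕ)) - Real.log 2)) ≤
      ENNReal.ofReal (7 / (k : ℝ) ^ 2) * B := by
  have hk0 : 0 < k := by omega
  have hl2 : Real.log 2 ≤ 1 := by linarith [Real.log_two_lt_d9]
  set c : ℕ := m - 1 with hc
  -- There are `M * c` neighbours of total output probability at most 1/4, so this `L` makes the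
  -- average of `L * Q` at most 1.
  set L : ℝ := 4 * M * c with hL
  have hL0 : 0 ≤ L := by positivity
  set K : ℝ := Real.log (1 + L) * (3 / 4) + (1 - Real.log 2) with hK
  have hK0 : 0 ≤ K := by
    have := Real.log_nonneg (show 1 ≤ 1 + L by linarith)
    linarith
  set κ : ℝ≥0∞ := ENNReal.ofReal (7 / (k : ℝ) ^ 2) with hκ
  set S : (Fin M → Fin m) → Multiset (Fin n) := spread hn hMm a b with hSdef
  have hS : ∀ x, S x ≠ 0 := fun x h => by
    have := congrArg Multiset.card h
    rw [hSdef, card_spread] at this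
    simp at this
    omega
  have hcard : ∀ x, (S x).card = k := fun x => by rw [hSdef, card_spread, hk]
  have hsucc : ∀ x, ENNReal.ofReal (3 / 4) < successProb A (S x) (hS x) := fun x => by
    refine lt_of_lt_of_le ?_ (hA _ (hS x) (hcard x))
    exact (ENNReal.ofReal_lt_ofReal_iff (by linarith)).2 (by linarith)
  set w : Fin M → Fin n → ℝ≥0∞ := fun i q => if (q : ℕ) / m = i then κ else 0 with hw
  set N : (Fin M → Fin m) → Fin M → ℝ≥0∞ :=
    fun x i => ⨆ t, queryCost A (answer _ (hS x)) (w i) t [] with hN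
  set Q : (Fin M → Fin m) → (Fin M → Fin m) → ℝ≥0∞ :=
    fun x' x => ⨆ t, runValue A (answer _ (hS x')) (hasOutput (S x)) t [] with hQ
  have key : ∀ x i y, ENNReal.ofReal K ≤
      N x i + ENNReal.ofReal (1 / 2) * (1 + ENNReal.ofReal L * Q (Function.update x i y) x) := by
    intro x i y
    have hkl := klBool_answer_spread_le hn hMm a b hk hk0 ha hb x i y (hS x) (hS _)
    refine change_of_measure_successProb A (hS x) (answer _ (hS _)) (w i) ?_
      (fun q => (hkl q).1) ?_ hL0 (hsucc x)
    · intro q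
      simp only [hw]
      split_ifs
      · exact ENNReal.ofReal_ne_top
      · exact ENNReal.zero_ne_top
    · intro q
      refine (hkl q).2.trans_eq ?_
      simp only [hw]
      split_ifs
      · rw [hκ, ENNReal.toReal_ofReal (by positivity)]
      · simp
  have hNsum : ∀ x, ∑ i, N x i ≤ κ * B := by
    intro x
    simp only [hN]
    rw [ENNReal.finsetSum_iSup_of_monotone fun i => queryCost_mono A _ (w i)]
    refine iSup_le fun t => (sum_queryCost_le _ A _ w κ ?_ t []).trans ?_
    · intro q
      by_cases hq : (q : ℕ) / m < M
      · rw [Finset.sum_eq_single ⟨(q : ℕ) / m, hq⟩]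
        · simp [hw]
        · intro j _ hj
          simp only [hw, ite_eq_right_iff]
          intro h
          exact absurd (Fin.ext h.symm) hj
        · simp
      · rw [Finset.sum_eq_zero]
        · exact zero_le
        · intro j _
          simp only [hw, ite_eq_right_iff]
          intro h
          have := j.isLt
          omega
    · gcongr
      exact (queryCost_one_le_expectedQueries A _ (hS x) t).trans (hB _ _ (hcard x))
  have hQsum : ∑ x : Fin M → Fin m, ∑ i, ∑ y with y ≠ x i, Q (Function.update x i y) x ≤
      Fintype.card (Fin M → Fin m) * ENNReal.ofReal (1 / 4) := by
    rw [sum_update_comm]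
    refine (Finset.sum_le_card_nsmul _ _ _ fun x _ =>
      sum_runValue_spread_update_le hn hMm a b A x (hS x) (hsucc x).le).trans_eq ?_
    rw [Finset.card_univ, nsmul_eq_mul]
  have hcardne : ∀ (x : Fin M → Fin m) (i : Fin M),
      (Finset.univ.filter fun y => y ≠ x i).card = c := fun x i => by
    rw [Finset.filter_ne', Finset.card_erase_of_mem (Finset.mem_univ _)]
    simp [hc]
  set X : ℕ := Fintype.card (Fin M → Fin m) with hX
  have hX0 : X ≠ 0 := by
    have : Nonempty (Fin M → Fin m) := ⟨fun _ => ⟨0, by omega⟩⟩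
    exact Fintype.card_ne_zero
  have htotal : (X * c : ℕ) * ENNReal.ofReal (M * K) ≤ (X * c : ℕ) * (κ * B + M) := by
    calc ((X * c : ℕ) : ℝ≥0∞) * ENNReal.ofReal (M * K)
        = ∑ x : Fin M → Fin m, ∑ i, ∑ y with y ≠ x i, ENNReal.ofReal K := by
          simp only [Finset.sum_const, hcardne, Finset.card_univ, ← hX, Fintype.card_fin,
            nsmul_eq_mul]
          rw [ENNReal.ofReal_mul (Nat.cast_nonneg M), ENNReal.ofReal_natCast, Nat.cast_mul]
          ring
      _ ≤ ∑ x : Fin M → Fin m, ∑ i, ∑ y with y ≠ x i, (N x i +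
            ENNReal.ofReal (1 / 2) * (1 + ENNReal.ofReal L * Q (Function.update x i y) x)) :=
          Finset.sum_le_sum fun x _ => Finset.sum_le_sum fun i _ => Finset.sum_le_sum fun y _ =>
            key x i y
      _ = c * ∑ x, ∑ i, N x i + ENNReal.ofReal (1 / 2) * (X * (M * c) + ENNReal.ofReal L *
            ∑ x : Fin M → Fin m, ∑ i, ∑ y with y ≠ x i, Q (Function.update x i y) x) := by
          simp only [Finset.sum_add_distrib, ← Finset.mul_sum, Finset.sum_const, hcardne,
            Finset.card_univ, ← hX, Fintype.card_fin, nsmul_eq_mul, mul_one]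
          rw [mul_left_comm (M : ℝ≥0∞)]
      _ ≤ c * (X * (κ * B)) + ENNReal.ofReal (1 / 2) * (X * (M * c) + ENNReal.ofReal L *
            (X * ENNReal.ofReal (1 / 4))) := by
          gcongr
          refine (Finset.sum_le_card_nsmul _ _ _ fun x _ => hNsum x).trans_eq ?_
          rw [Finset.card_univ, nsmul_eq_mul]
      _ = (X * c : ℕ) * (κ * B + M) := by
          have : ENNReal.ofReal (1 / 2) * (X * (M * c) + ENNReal.ofReal L *
              (X * ENNReal.ofReal (1 / 4))) = ((X * c * M : ℕ) : ℝ≥0∞) := by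
            simp only [← ENNReal.ofReal_natCast]
            rw [← ENNReal.ofReal_mul (by positivity), ← ENNReal.ofReal_mul (by positivity),
              ← ENNReal.ofReal_mul (by positivity), ← ENNReal.ofReal_mul (by positivity),
              ← ENNReal.ofReal_add (by positivity) (by positivity),
              ← ENNReal.ofReal_mul (by positivity)]
            congr 1
            push_cast
            rw [hL]
            ring
          rw [this]
          push_cast
          ring
  have h4 := (ENNReal.mul_le_mul_iff_right (by
    rw [Nat.cast_ne_zero]
    exact Nat.mul_ne_zero hX0 (by omega)) (ENNReal.natCast_ne_top _)).1 htotal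
  rw [show M * (3 / 4 * Real.log (1 + L) - Real.log 2) = M * K - M by rw [hK]; ring,
    ENNReal.ofReal_sub _ (Nat.cast_nonneg M), ENNReal.ofReal_natCast]
  exact tsub_le_iff_right.2 h4

end blocks

/-! ### Choice of parameters in the lower bound. -/

lemma log_div_ten_le {x : ℝ} (hx : 3 ≤ x) :
    1 / 10 * Real.log x ≤ 3 / 4 * Real.log x - Real.log 2 := by
  have h1 : Real.log 3 ≤ Real.log x := Real.log_le_log (by norm_num) hx
  -- Here `13 / 20 = 3 / 4 - 1 / 10`.
  have h2 : 20 * Real.log 2 ≤ 13 * Real.log 3 := by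
    have := Real.log_le_log (by norm_num) (show (2 : ℝ) ^ 20 ≤ 3 ^ 13 by norm_num)
    rw [Real.log_pow, Real.log_pow] at this
    exact_mod_cast this
  linarith

theorem lower_bound {n k : ℕ} {δ : ℝ} (hn : 2 ≤ n) (hk : 1 ≤ k) (hδ : δ < 1 / 4) :
    ENNReal.ofReal (1 / 350 * ((k : ℝ) ^ 2 * (min k n : ℕ) * Real.log n)) ≤
      expectedComplexity n k δ := by
  refine le_iInf₂ fun A hA => ?_
  set B : ℝ≥0∞ := ⨆ (S : Multiset (Fin n)) (hS : S ≠ 0) (_ : S.card = k), expectedQueries A S hS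
  have hB : ∀ (S : Multiset (Fin n)) (hS : S ≠ 0), S.card = k → expectedQueries A S hS ≤ B :=
    fun S hS h => le_iSup_of_le S (le_iSup₂_of_le hS h le_rfl)
  have hnR : (2 : ℝ) ≤ n := by exact_mod_cast hn
  have hlog : 0 ≤ Real.log n := Real.log_nonneg (by linarith)
  -- For `k < 3` the number `k / 3` of padding copies and of blocks would be 0.
  rcases Nat.lt_or_ge k 3 with hk3 | hk3
  · refine le_trans (ENNReal.ofReal_le_ofReal ?_)
      (log_le_of_determines hk hδ A hA (by omega) hB)
    refine le_trans ?_ (log_div_ten_le (by linarith))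
    have h1 : Real.log n ≤ Real.log (1 + n) := Real.log_le_log (by linarith) (by linarith)
    have h2 : k ^ 2 * min k n ≤ 8 := by
      calc k ^ 2 * min k n ≤ 2 ^ 2 * 2 := by gcongr <;> omega
        _ = 8 := by norm_num
    have h3 : (k : ℝ) ^ 2 * (min k n : ℕ) ≤ 8 := by exact_mod_cast h2
    nlinarith
  · set M : ℕ := min (k / 3) (n / 2) with hM
    set m : ℕ := n / M with hm
    have hM1 : 1 ≤ M := by omega
    have hm2 : 2 ≤ m := by
      rw [hm, Nat.le_div_iff_mul_le (by omega)]
      omega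
    have hMm : M * m ≤ n := Nat.mul_div_le n M
    have hnM : n < M * (m + 1) := by
      rw [mul_comm]
      exact (Nat.div_lt_iff_lt_mul (by omega)).1 (Nat.lt_succ_self _)
    -- With rounding, `k ≤ 5 * (k / 3)` for `k ≥ 3`, with equality at `k = 5`. The constant 350 is
    -- the product of 7 from the divergence, 10 from the logarithm and 5 from `min k n ≤ 5 * M`.
    have key := blocks_lower_bound (a := k / 3) (b := k - k / 3 - M) (by omega) hM1 hm2 hMm
      (by omega) (by omega) (by omega) hδ A hA hB
    have hL : n ≤ 4 * M * (m - 1) := by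
      obtain ⟨d, hd⟩ : ∃ d, m = d + 2 := ⟨m - 2, by omega⟩
      rw [hd] at hnM ⊢
      simp only [show d + 2 - 1 = d + 1 by omega]
      nlinarith
    have hLR : (n : ℝ) ≤ 4 * M * (m - 1 : ℕ) := by exact_mod_cast hL
    have h1 : 1 / 10 * Real.log n ≤
        3 / 4 * Real.log (1 + 4 * M * (m - 1 : ℕ)) - Real.log 2 := by
      refine le_trans ?_ (log_div_ten_le (by linarith))
      gcongr
      linarith
    have hkR : (0 : ℝ) < k := by exact_mod_cast hk
    calc ENNReal.ofReal (1 / 350 * ((k : ℝ) ^ 2 * (min k n : ℕ) * Real.log n))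
        ≤ ENNReal.ofReal ((k : ℝ) ^ 2 / 7 * (M *
            (3 / 4 * Real.log (1 + 4 * M * (m - 1 : ℕ)) - Real.log 2))) := by
          apply ENNReal.ofReal_le_ofReal
          have h2 : min k n ≤ 5 * M := by omega
          have h2R : ((min k n : ℕ) : ℝ) ≤ 5 * M := by exact_mod_cast h2
          calc 1 / 350 * ((k : ℝ) ^ 2 * (min k n : ℕ) * Real.log n)
              ≤ 1 / 350 * ((k : ℝ) ^ 2 * (5 * M) * Real.log n) := by gcongr
            _ = (k : ℝ) ^ 2 / 7 * (M * (1 / 10 * Real.log n)) := by ring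
            _ ≤ _ := by gcongr
      _ ≤ ENNReal.ofReal ((k : ℝ) ^ 2 / 7) * (ENNReal.ofReal (7 / (k : ℝ) ^ 2) * B) := by
          rw [ENNReal.ofReal_mul (by positivity)]
          gcongr
      _ = B := by
          rw [← mul_assoc, ← ENNReal.ofReal_mul (by positivity),
            div_mul_div_cancel₀ (by norm_num), div_self (by positivity), ENNReal.ofReal_one,
            one_mul]

/-! ### Algorithms with a fixed number of random queries. -/

section prober

variable {n : ℕ} {ι : Type*} [Fintype ι] [Nonempty ι]

/-- The algorithm that makes exactly `T` queries, each chosen uniformly from a finite family of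
candidates that depends on the transcript, and then gives an output. -/
def prober (T : ℕ) (cand : Transcript n → ι → Fin n) (out : Transcript n → Multiset (Fin n)) :
    Algorithm n := fun h =>
  if h.length < T then (PMF.uniformOfFintype ι).map fun i => Sum.inl (cand h i)
  else PMF.pure (Sum.inr (out h))

variable (T : ℕ) (cand : Transcript n → ι → Fin n) (out : Transcript n → Multiset (Fin n))
  (ρ : Fin n → PMF Bool)

lemma runValue_prober_succ (f : State n → ℝ≥0∞) (t : ℕ) (h : Transcript n) (hT : h.length < T) :
    runValue (prober T cand out) ρ f (t + 1) h = expect (PMF.uniformOfFintype ι) fun i =>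
      expect (ρ (cand h i)) fun b => runValue (prober T cand out) ρ f t ((cand h i, b) :: h) := by
  rw [runValue_succ, prober, if_pos hT, expect_map]
  rfl

lemma runValue_prober_stop (f : State n → ℝ≥0∞) (t : ℕ) (h : Transcript n)
    (hT : ¬ h.length < T) :
    runValue (prober T cand out) ρ f (t + 1) h = f (Sum.inr (out h)) := by
  rw [runValue_succ, prober, if_neg hT, expect_pure]
  rfl

/-- If the potential `Ψ` decreases by the factor `γ` in expectation with every query, and the
output is correct when `Ψ < 1`, then the probability of failure is at most `γ ^ T * Ψ []`. -/
lemma one_le_runValue_prober_add (S : Multiset (Fin n)) (Ψ : Transcript n → ℝ≥0∞) (γ : ℝ≥0∞)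
    (hΨ : ∀ h, (expect (PMF.uniformOfFintype ι) fun i =>
      expect (ρ (cand h i)) fun b => Ψ ((cand h i, b) :: h)) ≤ γ * Ψ h)
    (hout : ∀ h, Ψ h < 1 → out h = S) :
    1 ≤ runValue (prober T cand out) ρ (hasOutput S) (T + 1) [] + γ ^ T * Ψ [] := by
  -- With `t` queries left there are `t + 1` steps, the last one being spent on stopping.
  suffices H : ∀ t h, h.length + t = T →
      1 ≤ runValue (prober T cand out) ρ (hasOutput S) (t + 1) h + γ ^ t * Ψ h from
    H T [] (by simp)
  intro t
  induction t with
  | zero =>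
    intro h hT
    rw [runValue_prober_stop _ _ _ _ _ _ _ (by omega), pow_zero, one_mul]
    by_cases h1 : Ψ h < 1
    · rw [hout h h1, hasOutput_self]
      exact le_self_add
    · exact le_add_left (not_lt.1 h1)
  | succ t ih =>
    intro h hT
    rw [runValue_prober_succ _ _ _ _ _ _ _ (by omega)]
    calc (1 : ℝ≥0∞) = expect (PMF.uniformOfFintype ι) fun i => expect (ρ (cand h i)) fun _ => 1 := by
          simp [expect_const]
      _ ≤ expect (PMF.uniformOfFintype ι) fun i => expect (ρ (cand h i)) fun b =>
            runValue (prober T cand out) ρ (hasOutput S) (t + 1) ((cand h i, b) :: h) +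
              γ ^ t * Ψ ((cand h i, b) :: h) :=
          expect_mono _ fun i => expect_mono _ fun b => ih _ (by simp; omega)
      _ ≤ _ := by
          simp only [expect_add, expect_const_mul]
          rw [pow_succ, mul_assoc]
          gcongr
          exact hΨ h

lemma maxQueries_prober_le (S : Multiset (Fin n)) (hS : S ≠ 0) :
    maxQueries (prober T cand out) S hS ≤ T := by
  refine iSup₂_le fun t ht => ?_
  by_contra hlt
  rw [not_le, Nat.cast_lt] at hlt
  refine ht ?_
  rw [probAtLeast_eq]
  suffices H : ∀ t h, h.length ≤ T → T < h.length + t →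
      runValue (prober T cand out) (answer S hS) isRunning t h = 0 from
    H t [] (by simp) (by simpa using hlt)
  intro t
  induction t with
  | zero => intro h h1 h2; omega
  | succ t ih =>
    intro h h1 h2
    by_cases hT : h.length < T
    · rw [runValue_prober_succ _ _ _ _ _ _ _ hT]
      have : ∀ i b, runValue (prober T cand out) (answer S hS) isRunning t
          ((cand h i, b) :: h) = 0 := fun i b => ih _ (by simp; omega) (by simp; omega)
      simp [this, expect_const]
    · rw [runValue_prober_stop _ _ _ _ _ _ _ hT]
      rfl

end prober

/-! ### Scores and multiplicative weights. -/

section score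

variable {n : ℕ}

/-- The total evidence in the transcript `h` that at least a proportion `θ` of the hidden elements
is at most `y`, summed over the queries `y ≥ x`. -/
def score (θ : ℝ) (h : Transcript n) (x : Fin n) : ℝ :=
  (h.map fun e => if x ≤ e.1 then (if e.2 then 1 else 0) - θ else 0).sum

lemma score_cons (θ : ℝ) (y : Fin n) (b : Bool) (h : Transcript n) (x : Fin n) :
    score θ ((y, b) :: h) x =
      (if x ≤ y then (if b then 1 else 0) - θ else 0) + score θ h x := by
  simp [score]

/-- Only queries `y` with `x' ≤ y < x` contribute to the difference, each with `θ` minus the answer.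
-/
lemma score_sub_mono {θ θ' : ℝ} (hθ : θ ≤ θ') (h : Transcript n) {x x' : Fin n} (hx : x' ≤ x) :
    score θ h x - score θ h x' ≤ score θ' h x - score θ' h x' := by
  induction h with
  | nil => simp [score]
  | cons e h ih =>
    obtain ⟨y, b⟩ := e
    simp only [score_cons]
    by_cases h1 : x ≤ y
    · simp only [h1, hx.trans h1, if_true]
      linarith
    · by_cases h2 : x' ≤ y <;> simp only [h1, h2, if_true, if_false] <;> linarith

/-- The weight of the candidate `x` relative to that of `x₀`. -/
def relWeight (θ τ : ℝ) (x₀ : Fin n) (h : Transcript n) (x : Fin n) : ℝ :=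
  Real.exp (τ * (score θ h x - score θ h x₀))

lemma relWeight_pos (θ τ : ℝ) (x₀ : Fin n) (h : Transcript n) (x : Fin n) :
    0 < relWeight θ τ x₀ h x := Real.exp_pos _

lemma relWeight_nil (θ τ : ℝ) (x₀ x : Fin n) : relWeight θ τ x₀ [] x = 1 := by
  simp [relWeight, score]

lemma exp_le_one_add_add_sq {u : ℝ} (hu : |u| ≤ 1) : Real.exp u ≤ 1 + u + u ^ 2 := by
  have := (abs_le.1 (Real.abs_exp_sub_one_sub_id_le hu)).2
  linarith

/-- With `τ = 1 / (4 * κ)`, the first-order term is `-τ * (p - θ) ≤ -2 * τ ^ 2` and the second-order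
term is at most `τ ^ 2`; the net gain is `τ ^ 2`. -/
lemma exp_moment_le {κ p θ : ℝ} (hκ : 1 ≤ κ) (hp0 : 0 ≤ p) (hp1 : p ≤ 1) (hθ0 : 0 ≤ θ)
    (hθ1 : θ ≤ 1) (h : 1 / (2 * κ) ≤ p - θ) :
    p * Real.exp (-(1 / (4 * κ) * (1 - θ))) + (1 - p) * Real.exp (1 / (4 * κ) * θ) ≤
      1 - 1 / (16 * κ ^ 2) := by
  set τ := 1 / (4 * κ) with hτ
  have hτ0 : 0 < τ := by positivity
  have hτ1 : τ ≤ 1 := by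
    rw [hτ, div_le_one (by positivity)]
    linarith
  have e1 : 1 / (2 * κ) = 2 * τ := by rw [hτ]; field_simp; norm_num
  have e2 : 1 / (16 * κ ^ 2) = τ ^ 2 := by rw [hτ]; field_simp; norm_num
  rw [e1] at h
  rw [e2]
  have b1 : |-(τ * (1 - θ))| ≤ 1 := by
    rw [abs_neg, abs_of_nonneg (mul_nonneg hτ0.le (by linarith))]
    nlinarith
  have b2 : |τ * θ| ≤ 1 := by
    rw [abs_of_nonneg (by positivity)]
    nlinarith
  have k1 := mul_le_mul_of_nonneg_left (exp_le_one_add_add_sq b1) hp0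
  have k2 := mul_le_mul_of_nonneg_left (exp_le_one_add_add_sq b2) (sub_nonneg.2 hp1)
  have k3 : p * (1 - θ) ^ 2 + (1 - p) * θ ^ 2 ≤ 1 := by
    have : (1 - θ) ^ 2 ≤ 1 := by nlinarith
    have : θ ^ 2 ≤ 1 := by nlinarith
    nlinarith
  have k4 := mul_le_mul_of_nonneg_left k3 (sq_nonneg τ)
  have k5 := mul_le_mul_of_nonneg_left h hτ0.le
  nlinarith

lemma exp_moment_le' {κ p θ : ℝ} (hκ : 1 ≤ κ) (hp0 : 0 ≤ p) (hp1 : p ≤ 1) (hθ0 : 0 ≤ θ)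
    (hθ1 : θ ≤ 1) (h : 1 / (2 * κ) ≤ θ - p) :
    p * Real.exp (1 / (4 * κ) * (1 - θ)) + (1 - p) * Real.exp (-(1 / (4 * κ) * θ)) ≤
      1 - 1 / (16 * κ ^ 2) := by
  have := exp_moment_le (p := 1 - p) (θ := 1 - θ) hκ (by linarith) (by linarith) (by linarith)
    (by linarith) (by linarith)
  rw [sub_sub_cancel, sub_sub_cancel] at this
  linarith

/-- One query shrinks, in expectation, the relative weight of every candidate that it separates
from the true one. -/
lemma relWeight_step {κ θ p : ℝ} {x₀ y : Fin n} (hκ : 1 ≤ κ) (hp0 : 0 ≤ p) (hp1 : p ≤ 1)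
    (hθ0 : 0 ≤ θ) (hθ1 : θ ≤ 1) (hge : x₀ ≤ y → 1 / (2 * κ) ≤ p - θ)
    (hlt : ¬ x₀ ≤ y → 1 / (2 * κ) ≤ θ - p) (h : Transcript n) (x : Fin n) :
    p * relWeight θ (1 / (4 * κ)) x₀ ((y, true) :: h) x +
        (1 - p) * relWeight θ (1 / (4 * κ)) x₀ ((y, false) :: h) x ≤
      relWeight θ (1 / (4 * κ)) x₀ h x -
        1 / (16 * κ ^ 2) * if (x ≤ y ↔ x₀ ≤ y) then 0 else relWeight θ (1 / (4 * κ)) x₀ h x := by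
  have hpos := relWeight_pos θ (1 / (4 * κ)) x₀ h x
  have e : ∀ b : Bool, relWeight θ (1 / (4 * κ)) x₀ ((y, b) :: h) x =
      relWeight θ (1 / (4 * κ)) x₀ h x * Real.exp (1 / (4 * κ) *
        ((if x ≤ y then (if b then 1 else 0) - θ else 0) -
          (if x₀ ≤ y then (if b then 1 else 0) - θ else 0))) := by
    intro b
    rw [relWeight, relWeight, ← Real.exp_add, score_cons, score_cons]
    congr 1
    ring
  rw [e, e]
  by_cases h1 : x ≤ y <;> by_cases h2 : x₀ ≤ y
  · simp only [h1, h2, sub_self, mul_zero, Real.exp_zero, if_true]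
    linarith
  · have := mul_le_mul_of_nonneg_left (exp_moment_le' hκ hp0 hp1 hθ0 hθ1 (hlt h2)) hpos.le
    have e0 : 1 / (4 * κ) * (0 - θ) = -(1 / (4 * κ) * θ) := by ring
    simp only [h1, h2, if_true, if_false, sub_zero, iff_false, not_true, Bool.false_eq_true, e0]
    linarith
  · have := mul_le_mul_of_nonneg_left (exp_moment_le hκ hp0 hp1 hθ0 hθ1 (hge h2)) hpos.le
    have e0 : 1 / (4 * κ) * (0 - (0 - θ)) = 1 / (4 * κ) * θ := by ring
    have e1 : 1 / (4 * κ) * (0 - (1 - θ)) = -(1 / (4 * κ) * (1 - θ)) := by ring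
    simp only [h1, h2, if_true, if_false, iff_true, Bool.false_eq_true, e0, e1]
    linarith
  · simp only [h1, h2, sub_self, mul_zero, Real.exp_zero, if_false, if_true]
    linarith

end score

/-! ### Queries that separate much weight. -/

section median

variable {n : ℕ}

/-- The total weight of the candidates that the query `y` separates from `x₀`. -/
def oppWeight (W : Fin n → ℝ) (x₀ y : Fin n) : ℝ := ∑ x, if (x ≤ y ↔ x₀ ≤ y) then 0 else W x

lemma oppWeight_nonneg {W : Fin n → ℝ} (hW : ∀ x, 0 ≤ W x) (x₀ y : Fin n) :
    0 ≤ oppWeight W x₀ y :=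
  Finset.sum_nonneg fun x _ => by split_ifs <;> simp [hW]

/-- Each `x ≠ x₀` is separated from `x₀` by at least one query, namely `min x x₀`. -/
lemma sum_ne_le_sum_oppWeight {W : Fin n → ℝ} (hW : ∀ x, 0 ≤ W x) (x₀ : Fin n) :
    ∑ x with x ≠ x₀, W x ≤ ∑ y, oppWeight W x₀ y := by
  unfold oppWeight
  rw [Finset.sum_comm, Finset.sum_filter]
  refine Finset.sum_le_sum fun x _ => ?_
  have hnn : ∀ y ∈ Finset.univ, 0 ≤ if (x ≤ y ↔ x₀ ≤ y) then 0 else W x := fun y _ => by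
    split_ifs <;> simp [hW]
  split_ifs with hx
  · refine le_trans ?_ (Finset.single_le_sum hnn (Finset.mem_univ (min x x₀)))
    rw [if_neg]
    intro h
    rcases lt_or_gt_of_ne hx with hlt | hlt
    · rw [min_eq_left hlt.le] at h
      exact absurd (h.1 le_rfl) (not_le.2 hlt)
    · rw [min_eq_right hlt.le] at h
      exact absurd (h.2 le_rfl) (not_le.2 hlt)
  · exact Finset.sum_nonneg hnn

/-- `m` is the least candidate such that at least half of the weight is at most `m`. -/
def IsMedian (W : Fin n → ℝ) (m : Fin n) : Prop :=
  ∑ x, W x ≤ 2 * ∑ x with x ≤ m, W x ∧ ∀ y < m, 2 * ∑ x with x ≤ y, W x < ∑ x, W x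

lemma exists_isMedian (hn : 0 < n) {W : Fin n → ℝ} (hW : ∀ x, 0 ≤ W x) : ∃ m, IsMedian W m := by
  set D : Finset (Fin n) := Finset.univ.filter fun y => ∑ x, W x ≤ 2 * ∑ x with x ≤ y, W x
  have hD : D.Nonempty := by
    refine ⟨⟨n - 1, by omega⟩, ?_⟩
    have : ∀ x : Fin n, x ≤ ⟨n - 1, by omega⟩ := fun x => by
      rw [Fin.le_def]
      have := x.isLt
      simp only
      omega
    simp only [D, Finset.mem_filter, Finset.mem_univ, true_and, this, Finset.filter_true]
    have := Finset.sum_nonneg fun x (_ : x ∈ Finset.univ) => hW x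
    linarith
  refine ⟨D.min' hD, (Finset.mem_filter.1 (D.min'_mem hD)).2, fun y hy => ?_⟩
  by_contra h
  exact absurd (D.min'_le y (Finset.mem_filter.2 ⟨Finset.mem_univ _, not_lt.1 h⟩)) (not_le.2 hy)

lemma IsMedian.mul_const {W : Fin n → ℝ} {m : Fin n} (h : IsMedian W m) {c : ℝ} (hc : 0 < c) :
    IsMedian (fun x => W x * c) m := by
  simp only [IsMedian, ← Finset.sum_mul, ← mul_assoc]
  exact ⟨mul_le_mul_of_nonneg_right h.1 hc.le, fun y hy => mul_lt_mul_of_pos_right (h.2 y hy) hc⟩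

/-- The predecessor of `m`, or `m` itself if it is the least element. -/
def prev (m : Fin n) : Fin n := ⟨m - 1, by omega⟩

/-- If `x₀` is above the median `m`, the query `m` separates at least half of the weight; if below,
`prev m` does. If `x₀ = m`, one query separates everything above and the other everything below. The
predecessor is needed because a query `y` cuts just after `y`. -/
lemma sum_ne_le_oppWeight_add {W : Fin n → ℝ} (hW : ∀ x, 0 ≤ W x) {m : Fin n}
    (hm : IsMedian W m) (x₀ : Fin n) :
    ∑ x with x ≠ x₀, W x ≤ 2 * (oppWeight W x₀ m + oppWeight W x₀ (prev m)) := by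
  have h0 := oppWeight_nonneg hW x₀ m
  have h1 := oppWeight_nonneg hW x₀ (prev m)
  have hle : ∑ x with x ≠ x₀, W x ≤ ∑ x, W x :=
    Finset.sum_le_sum_of_subset_of_nonneg (Finset.filter_subset _ _) fun x _ _ => hW x
  rcases lt_trichotomy x₀ m with hlt | heq | hgt
  · have hpx : x₀ ≤ prev m := by
      rw [Fin.le_def]
      rw [Fin.lt_def] at hlt
      simp only [prev]
      omega
    have hpm : prev m < m := by
      rw [Fin.lt_def] at *
      simp only [prev]
      omega
    have h2 := hm.2 _ hpm
    have h3 : oppWeight W x₀ (prev m) = ∑ x, W x - ∑ x with x ≤ prev m, W x := by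
      rw [oppWeight, Finset.sum_filter, ← Finset.sum_sub_distrib]
      refine Finset.sum_congr rfl fun x _ => ?_
      by_cases hx : x ≤ prev m <;> simp [hx, hpx]
    linarith
  · subst heq
    have h2 : ∑ x with x ≠ x₀, W x ≤ oppWeight W x₀ x₀ + oppWeight W x₀ (prev x₀) := by
      rw [oppWeight, oppWeight, ← Finset.sum_add_distrib, Finset.sum_filter]
      refine Finset.sum_le_sum fun x _ => ?_
      rcases lt_trichotomy x x₀ with hx | hx | hx
      · have e1 : x ≤ prev x₀ := by
          rw [Fin.le_def]
          rw [Fin.lt_def] at hx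
          simp only [prev]
          omega
        have e2 : ¬ x₀ ≤ prev x₀ := by
          rw [Fin.le_def]
          rw [Fin.lt_def] at hx
          simp only [prev]
          omega
        simp [hx.ne, e1, e2, hx.le]
      · simp [hx]
      · have e1 : ¬ x ≤ x₀ := not_le.2 hx
        simp only [hx.ne', e1, ne_eq, not_false_eq_true, if_true, le_refl, iff_true, if_false]
        have := hW x
        split_ifs <;> linarith
    linarith
  · have h2 := hm.1
    have h3 : oppWeight W x₀ m = ∑ x with x ≤ m, W x := by
      rw [oppWeight, Finset.sum_filter]
      refine Finset.sum_congr rfl fun x _ => ?_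
      by_cases hx : x ≤ m <;> simp [hx, not_le.2 hgt]
    linarith

end median

/-! ### The potential and the correctness of the output. -/

section potential

variable {n k : ℕ}

/-- The midpoint between the proportions of elements at most `y` for `y` less than the `j`-th
smallest hidden element and for `y` at least that element, with `j` counted from `0`. -/
def level (j : Fin k) : ℝ := ((j : ℝ) + 1 / 2) / k

lemma level_nonneg (j : Fin k) : 0 ≤ level j := by unfold level; positivity

lemma level_le_one (j : Fin k) : level j ≤ 1 := by
  have hk : (0 : ℝ) < k := by exact_mod_cast j.pos
  have : ((j : ℕ) : ℝ) + 1 ≤ k := by exact_mod_cast j.isLt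
  rw [level, div_le_one hk]
  linarith

lemma level_mono {i j : Fin k} (h : i ≤ j) : level i ≤ level j := by
  have : ((i : ℕ) : ℝ) ≤ (j : ℕ) := by exact_mod_cast h
  unfold level
  gcongr

lemma countLE_univ_map (x : Fin k → Fin n) (y : Fin n) :
    countLE (Finset.univ.val.map x) y = (Finset.univ.filter fun i => x i ≤ y).card := by
  rw [countLE_map]
  rfl

lemma lt_countLE_of_le {x : Fin k → Fin n} (hx : Monotone x) {j : Fin k} {y : Fin n}
    (h : x j ≤ y) : (j : ℕ) + 1 ≤ countLE (Finset.univ.val.map x) y := by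
  rw [countLE_univ_map, ← Fin.card_Iic]
  refine Finset.card_le_card fun i hi => ?_
  simp only [Finset.mem_filter, Finset.mem_univ, true_and]
  exact (hx (Finset.mem_Iic.1 hi)).trans h

lemma countLE_le_of_not_le {x : Fin k → Fin n} (hx : Monotone x) {j : Fin k} {y : Fin n}
    (h : ¬ x j ≤ y) : countLE (Finset.univ.val.map x) y ≤ j := by
  rw [countLE_univ_map, ← Fin.card_Iio]
  refine Finset.card_le_card fun i hi => ?_
  simp only [Finset.mem_filter, Finset.mem_univ, true_and] at hi
  rw [Finset.mem_Iio]
  by_contra hij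
  exact h ((hx (not_lt.1 hij)).trans hi)

lemma exists_monotone_map_eq (S : Multiset (Fin n)) :
    ∃ x : Fin S.card → Fin n, Monotone x ∧ S = Finset.univ.val.map x := by
  have hl : (S.sort (· ≤ ·)).length = S.card := S.length_sort _
  refine ⟨fun j => (S.sort (· ≤ ·)).get (j.cast hl.symm), fun i j hij => ?_, ?_⟩
  · exact (S.pairwise_sort (· ≤ ·)).sortedLE.monotone_get (by simpa using hij)
  · conv_lhs => rw [← S.sort_eq (· ≤ ·)]
    rw [Fin.univ_val_map]
    congr 1
    apply List.ext_get
    · simp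
    · intro m h1 h2
      simp

/-- The total relative weight of the wrong candidates for the `j`-th smallest hidden element. -/
def wrongWeight (x : Fin k → Fin n) (h : Transcript n) (j : Fin k) : ℝ :=
  ∑ z with z ≠ x j, relWeight (level j) (1 / (4 * k)) (x j) h z

lemma wrongWeight_step {x : Fin k → Fin n} (hx : Monotone x) (h : Transcript n) (j : Fin k)
    (y : Fin n) {p : ℝ} (hp : p = countLE (Finset.univ.val.map x) y / k) :
    p * wrongWeight x ((y, true) :: h) j + (1 - p) * wrongWeight x ((y, false) :: h) j ≤
      wrongWeight x h j -
        1 / (16 * (k : ℝ) ^ 2) * oppWeight (relWeight (level j) (1 / (4 * k)) (x j) h) (x j) y := by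
  have hk : (0 : ℝ) < k := by exact_mod_cast j.pos
  have hk1 : (1 : ℝ) ≤ k := by exact_mod_cast j.pos
  have hp0 : 0 ≤ p := by rw [hp]; positivity
  have hp1 : p ≤ 1 := by
    rw [hp, div_le_one hk]
    have := countLE_le_card (Finset.univ.val.map x) y
    rw [Multiset.card_map] at this
    simp only [Finset.card_val, Finset.card_univ, Fintype.card_fin] at this
    exact_mod_cast this
  have hge : x j ≤ y → 1 / (2 * (k : ℝ)) ≤ p - level j := by
    intro hj
    have : (((j : ℕ) + 1 : ℕ) : ℝ) ≤ countLE (Finset.univ.val.map x) y := by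
      exact_mod_cast lt_countLE_of_le hx hj
    push_cast at this
    rw [hp, level, ← sub_div, div_le_div_iff₀ (by positivity) hk]
    nlinarith
  have hlt : ¬ x j ≤ y → 1 / (2 * (k : ℝ)) ≤ level j - p := by
    intro hj
    have : (countLE (Finset.univ.val.map x) y : ℝ) ≤ (j : ℕ) := by
      exact_mod_cast countLE_le_of_not_le hx hj
    rw [hp, level, ← sub_div, div_le_div_iff₀ (by positivity) hk]
    nlinarith
  -- No query separates `x j` from itself, so dropping it changes nothing.
  have hopp : oppWeight (relWeight (level j) (1 / (4 * k)) (x j) h) (x j) y =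
      ∑ z with z ≠ x j, if (z ≤ y ↔ x j ≤ y) then 0 else
        relWeight (level j) (1 / (4 * k)) (x j) h z := by
    rw [oppWeight, Finset.sum_filter]
    refine Finset.sum_congr rfl fun z _ => ?_
    by_cases hz : z = x j <;> simp [hz]
  rw [hopp, wrongWeight, wrongWeight, wrongWeight, Finset.mul_sum, Finset.mul_sum, Finset.mul_sum,
    ← Finset.sum_add_distrib, ← Finset.sum_sub_distrib]
  exact Finset.sum_le_sum fun z _ => relWeight_step hk1 hp0 hp1 (level_nonneg j) (level_le_one j)
    hge hlt h z

/-- The best candidate for the element at the level `θ`, when there is a single best one. -/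
def bestGuess (hn : 0 < n) (θ : ℝ) (h : Transcript n) : Fin n :=
  open Classical in
  if hx : ∃ x, ∀ z, z ≠ x → score θ h z < score θ h x then hx.choose else ⟨0, hn⟩

lemma bestGuess_eq (hn : 0 < n) {θ : ℝ} {h : Transcript n} {x : Fin n}
    (hx : ∀ z, z ≠ x → score θ h z < score θ h x) : bestGuess hn θ h = x := by
  have hex : ∃ x, ∀ z, z ≠ x → score θ h z < score θ h x := ⟨x, hx⟩
  rw [bestGuess, dif_pos hex]
  by_contra hne
  exact lt_asymm (hx _ hne) (hex.choose_spec _ (Ne.symm hne))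

/-- The indices of the first and of the last occurrences of the values of `x`. -/
def extremeIndices (x : Fin k → Fin n) : Finset (Fin k) :=
  open Classical in
  Finset.univ.filter fun j => (∀ i, x i = x j → i ≤ j) ∨ ∀ i, x i = x j → j ≤ i

lemma card_extremeIndices_le (x : Fin k → Fin n) : (extremeIndices x).card ≤ 2 * n := by
  classical
  have h1 : (Finset.univ.filter fun j => ∀ i, x i = x j → i ≤ j).card ≤ n := by
    simpa using Finset.card_le_card_of_injOn x (t := Finset.univ) (fun _ _ => by simp)
      fun i hi j hj hij => by
        simp only [Finset.coe_filter, Set.mem_ofPred_eq] at hi hj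
        exact le_antisymm (hj.2 i hij) (hi.2 j hij.symm)
  have h2 : (Finset.univ.filter fun j => ∀ i, x i = x j → j ≤ i).card ≤ n := by
    simpa using Finset.card_le_card_of_injOn x (t := Finset.univ) (fun _ _ => by simp)
      fun i hi j hj hij => by
        simp only [Finset.coe_filter, Set.mem_ofPred_eq] at hi hj
        exact le_antisymm (hi.2 j hij.symm) (hj.2 i hij)
  have h3 := Finset.card_union_le (Finset.univ.filter fun j => ∀ i, x i = x j → i ≤ j)
    (Finset.univ.filter fun j => ∀ i, x i = x j → j ≤ i)
  rw [← Finset.filter_or] at h3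
  unfold extremeIndices
  convert h3.trans (show _ ≤ 2 * n by omega) using 2

lemma exists_extremeIndices (x : Fin k → Fin n) (j : Fin k) :
    (∃ i ∈ extremeIndices x, x i = x j ∧ i ≤ j) ∧ ∃ i ∈ extremeIndices x, x i = x j ∧ j ≤ i := by
  set D : Finset (Fin k) := Finset.univ.filter fun i => x i = x j
  have hj : j ∈ D := by simp [D]
  have hmin := D.min'_mem ⟨j, hj⟩
  have hmax := D.max'_mem ⟨j, hj⟩
  have hDx : ∀ i ∈ D, x i = x j := fun i hi => (Finset.mem_filter.1 hi).2
  constructor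
  · refine ⟨D.min' ⟨j, hj⟩, ?_, hDx _ hmin, D.min'_le j hj⟩
    simp only [extremeIndices, Finset.mem_filter, Finset.mem_univ, true_and]
    right
    intro i hi
    exact D.min'_le i (by simpa [D] using hi.trans (hDx _ hmin))
  · refine ⟨D.max' ⟨j, hj⟩, ?_, hDx _ hmax, D.le_max' j hj⟩
    simp only [extremeIndices, Finset.mem_filter, Finset.mem_univ, true_and]
    left
    intro i hi
    exact D.le_max' i (by simpa [D] using hi.trans (hDx _ hmax))

/-- The potential that controls the probability of a wrong output. -/
def potential (x : Fin k → Fin n) (h : Transcript n) : ℝ :=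
  ∑ j ∈ extremeIndices x, wrongWeight x h j

lemma wrongWeight_nonneg (x : Fin k → Fin n) (h : Transcript n) (j : Fin k) :
    0 ≤ wrongWeight x h j :=
  Finset.sum_nonneg fun _ _ => (relWeight_pos _ _ _ _ _).le

lemma potential_nonneg (x : Fin k → Fin n) (h : Transcript n) : 0 ≤ potential x h :=
  Finset.sum_nonneg fun j _ => wrongWeight_nonneg x h j

/-- At most `2 * n` extreme indices, each with fewer than `n` wrong candidates of initial weight 1.
The bound is free of `k`, so the query count involves `log n` even when `k` is much larger than `n`.
-/
lemma potential_nil_le (x : Fin k → Fin n) : potential x [] ≤ 2 * (n : ℝ) ^ 2 := by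
  have h1 : ∀ j, wrongWeight x [] j ≤ n := fun j => by
    simp only [wrongWeight, relWeight_nil, Finset.sum_const, nsmul_eq_mul, mul_one]
    have := Finset.card_filter_le (Finset.univ : Finset (Fin n)) fun z => z ≠ x j
    simp only [Finset.card_univ, Fintype.card_fin] at this
    exact_mod_cast this
  have h2 : ((extremeIndices x).card : ℝ) ≤ 2 * n := by exact_mod_cast card_extremeIndices_le x
  calc potential x [] ≤ (extremeIndices x).card • (n : ℝ) :=
        Finset.sum_le_card_nsmul _ _ _ fun j _ => h1 j
    _ ≤ (2 * n) * n := by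
        rw [nsmul_eq_mul]
        gcongr
    _ = _ := by ring

lemma score_lt_of_potential_lt_one {x : Fin k → Fin n} {h : Transcript n}
    (hlt : potential x h < 1) {j : Fin k} (hj : j ∈ extremeIndices x) {z : Fin n}
    (hz : z ≠ x j) : score (level j) h z < score (level j) h (x j) := by
  have h1 : wrongWeight x h j ≤ potential x h :=
    Finset.single_le_sum (fun j _ => wrongWeight_nonneg x h j) hj
  have h2 : relWeight (level j) (1 / (4 * k)) (x j) h z ≤ wrongWeight x h j :=
    Finset.single_le_sum (f := relWeight (level j) (1 / (4 * k)) (x j) h)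
      (fun z _ => (relWeight_pos _ _ _ _ z).le) (by simpa using hz)
  have h3 := (h2.trans h1).trans_lt hlt
  rw [relWeight, Real.exp_lt_one_iff] at h3
  have hk : (0 : ℝ) < k := by exact_mod_cast j.pos
  exact sub_neg.1 (neg_of_mul_neg_right h3 (by positivity))

/-- An arbitrary rank lies between the first and the last rank with the same value. By
`score_sub_mono`, the first beats every smaller candidate on its behalf, and the last every larger
one. -/
lemma bestGuess_eq_of_potential_lt_one (hn : 0 < n) {x : Fin k → Fin n} {h : Transcript n}
    (hlt : potential x h < 1) (j : Fin k) : bestGuess hn (level j) h = x j := by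
  refine bestGuess_eq hn fun z hz => ?_
  obtain ⟨⟨i, hi, hxi, hij⟩, ⟨i', hi', hxi', hij'⟩⟩ := exists_extremeIndices x j
  rcases lt_or_gt_of_ne hz with hlt' | hgt
  · have h1 := score_lt_of_potential_lt_one hlt hi (z := z) (by rwa [hxi])
    have h2 := score_sub_mono (level_mono hij) h hlt'.le
    rw [hxi] at h1
    linarith
  · have h1 := score_lt_of_potential_lt_one hlt hi' (z := z) (by rwa [hxi'])
    have h2 := score_sub_mono (level_mono hij') h hgt.le
    rw [hxi'] at h1
    linarith

end potential

/-! ### Query strategies and the upper bound. -/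

section upper

variable {n k : ℕ} {ι : Type*} [Fintype ι] [Nonempty ι]

lemma expect_uniform (f : ι → ℝ≥0∞) :
    expect (PMF.uniformOfFintype ι) f = (Fintype.card ι : ℝ≥0∞)⁻¹ * ∑ i, f i := by
  simp [expect, tsum_fintype, Finset.mul_sum]

lemma expect_answer_ofReal (S : Multiset (Fin n)) (hS : S ≠ 0) (y : Fin n) {F : Bool → ℝ}
    (hF : ∀ b, 0 ≤ F b) : expect (answer S hS y) (fun b => ENNReal.ofReal (F b)) =
      ENNReal.ofReal (countLE S y / S.card * F true + (1 - countLE S y / S.card) * F false) := by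
  rw [← answer_false_toReal S hS, ← answer_true_toReal S hS, expect_bool,
    ENNReal.ofReal_add (mul_nonneg ENNReal.toReal_nonneg (hF _))
      (mul_nonneg ENNReal.toReal_nonneg (hF _)),
    ENNReal.ofReal_mul ENNReal.toReal_nonneg, ENNReal.ofReal_mul ENNReal.toReal_nonneg,
    ENNReal.ofReal_toReal ((answer S hS y).apply_ne_top _),
    ENNReal.ofReal_toReal ((answer S hS y).apply_ne_top _)]

/-- If the candidate queries separate, on average, a proportion `1 / (4 * r)` of the weight of the
wrong candidates from the true one, then the potential decreases geometrically. -/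
lemma expect_potential_le {x : Fin k → Fin n} (hx : Monotone x)
    (hS : Finset.univ.val.map x ≠ 0) (q : ι → Fin n) (h : Transcript n) {r : ℝ}
    (hq : ∀ j, Fintype.card ι * (1 / (4 * r)) * wrongWeight x h j ≤
      ∑ i, oppWeight (relWeight (level j) (1 / (4 * k)) (x j) h) (x j) (q i)) :
    (expect (PMF.uniformOfFintype ι) fun i => expect (answer _ hS (q i)) fun b =>
        ENNReal.ofReal (potential x ((q i, b) :: h))) ≤
      ENNReal.ofReal ((1 - 1 / (64 * (k : ℝ) ^ 2 * r)) * potential x h) := by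
  have hcard : (Finset.univ.val.map x).card = k := by simp
  have hN : (0 : ℝ) < Fintype.card ι := by exact_mod_cast Fintype.card_pos
  simp only [expect_answer_ofReal _ hS _ fun b => potential_nonneg x _, hcard]
  set G : ι → ℝ := fun i => countLE (Finset.univ.val.map x) (q i) / k *
    potential x ((q i, true) :: h) + (1 - countLE (Finset.univ.val.map x) (q i) / k) *
      potential x ((q i, false) :: h) with hG
  have hG0 : ∀ i, 0 ≤ G i := fun i => by
    have h1 : (countLE (Finset.univ.val.map x) (q i) : ℝ) / k ≤ 1 := by
      refine div_le_one_of_le₀ ?_ (Nat.cast_nonneg k)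
      have := countLE_le_card (Finset.univ.val.map x) (q i)
      rw [hcard] at this
      exact_mod_cast this
    exact add_nonneg (mul_nonneg (by positivity) (potential_nonneg _ _))
      (mul_nonneg (by linarith) (potential_nonneg _ _))
  rw [expect_uniform, ← ENNReal.ofReal_sum_of_nonneg fun i _ => hG0 i, ← ENNReal.ofReal_natCast,
    ← ENNReal.ofReal_inv_of_pos hN, ← ENNReal.ofReal_mul (by positivity)]
  apply ENNReal.ofReal_le_ofReal
  rw [inv_mul_le_iff₀ hN]
  have h1 : ∀ i, G i ≤ ∑ j ∈ extremeIndices x, (wrongWeight x h j - 1 / (16 * (k : ℝ) ^ 2) *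
      oppWeight (relWeight (level j) (1 / (4 * k)) (x j) h) (x j) (q i)) := fun i => by
    simp only [hG, potential]
    rw [Finset.mul_sum, Finset.mul_sum, ← Finset.sum_add_distrib]
    exact Finset.sum_le_sum fun j _ => wrongWeight_step hx h j (q i) rfl
  refine (Finset.sum_le_sum fun i _ => h1 i).trans ?_
  rw [Finset.sum_comm, potential, Finset.mul_sum, Finset.mul_sum]
  refine Finset.sum_le_sum fun j _ => ?_
  rw [Finset.sum_sub_distrib, ← Finset.mul_sum, Finset.sum_const, Finset.card_univ, nsmul_eq_mul]
  have h2 := mul_le_mul_of_nonneg_left (hq j) (show 0 ≤ 1 / (16 * (k : ℝ) ^ 2) by positivity)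
  have h3 : (Fintype.card ι : ℝ) * ((1 - 1 / (64 * (k : ℝ) ^ 2 * r)) * wrongWeight x h j) =
      Fintype.card ι * wrongWeight x h j -
        1 / (16 * (k : ℝ) ^ 2) * (Fintype.card ι * (1 / (4 * r)) * wrongWeight x h j) := by
    have : 1 / (64 * (k : ℝ) ^ 2 * r) = 1 / (16 * (k : ℝ) ^ 2) * (1 / (4 * r)) := by
      rw [div_mul_div_comm]
      ring
    rw [this]
    ring
  rw [h3]
  linarith

lemma exists_monotone_of_card_eq {S : Multiset (Fin n)} (hS : S.card = k) :
    ∃ x : Fin k → Fin n, Monotone x ∧ S = Finset.univ.val.map x := by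
  subst hS
  exact exists_monotone_map_eq S

/-- The output that collects the best guesses at all the levels. -/
def collectGuesses (hn : 0 < n) (k : ℕ) (h : Transcript n) : Multiset (Fin n) :=
  Finset.univ.val.map fun j : Fin k => bestGuess hn (level j) h

/-- Separating a fraction `1 / (4 * r)` of the wrong weight per query makes the potential contract
by `1 - 1 / (64 * k ^ 2 * r)`; the two strategies differ only in `r`. -/
lemma worstCaseComplexity_le_of_candidates (hn : 2 ≤ n) (hk : 1 ≤ k) {β δ : ℝ} (hβ : 0 < β)
    (hδ : (n : ℝ) ^ (-β) < δ) {r : ℕ} (hr : 1 ≤ r) (cand : Transcript n → ι → Fin n)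
    (hcand : ∀ (x : Fin k → Fin n) (h : Transcript n) (j : Fin k),
      Fintype.card ι * (1 / (4 * (r : ℝ))) * wrongWeight x h j ≤
        ∑ i, oppWeight (relWeight (level j) (1 / (4 * k)) (x j) h) (x j) (cand h i)) :
    worstCaseComplexity n k δ ≤
      ENNReal.ofReal ((64 * (β + 3) + 2) * ((k : ℝ) ^ 2 * r * Real.log n)) := by
  have hnR : (2 : ℝ) ≤ n := by exact_mod_cast hn
  have hkR : (1 : ℝ) ≤ k := by exact_mod_cast hk
  have hrR : (1 : ℝ) ≤ r := by exact_mod_cast hr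
  have hk2 : (1 : ℝ) ≤ (k : ℝ) ^ 2 := one_le_pow₀ hkR
  have hlog : 1 / 2 ≤ Real.log n := by
    have := Real.log_le_log (by norm_num) hnR
    linarith [Real.log_two_gt_d9]
  set D : ℝ := 64 * (k : ℝ) ^ 2 * r with hD
  have hD1 : 1 ≤ D := by nlinarith
  -- The contraction over `T` queries is at most `n ^ (-(β + 3))`; the extra 3 absorbs the initial
  -- potential `2 * n ^ 2 ≤ n ^ 3`. The rounding up is paid for by the summand 2 in the final
  -- constant.
  set T : ℕ := ⌈D * ((β + 3) * Real.log n)⌉₊ with hT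
  have hTge : D * ((β + 3) * Real.log n) ≤ T := Nat.le_ceil _
  have hTle : (T : ℝ) ≤ (64 * (β + 3) + 2) * ((k : ℝ) ^ 2 * r * Real.log n) := by
    have h1 : (T : ℝ) < D * ((β + 3) * Real.log n) + 1 := Nat.ceil_lt_add_one (by positivity)
    have h2 : 1 / 2 ≤ (k : ℝ) ^ 2 * r * Real.log n := by
      have : 1 ≤ (k : ℝ) ^ 2 * r := by nlinarith
      nlinarith
    rw [hD] at h1
    linarith
  set A : Algorithm n := prober T cand (collectGuesses (by omega) k) with hA
  refine (iInf₂_le A ?_).trans ?_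
  · intro S hS hcard
    obtain ⟨x, hx, rfl⟩ := exists_monotone_of_card_eq hcard
    set γ : ℝ := 1 - 1 / D with hγ
    have hγ0 : 0 ≤ γ := by
      rw [hγ, sub_nonneg, div_le_one (by linarith)]
      exact hD1
    have key := one_le_runValue_prober_add T cand (collectGuesses (by omega) k)
      (answer _ hS) (Finset.univ.val.map x) (fun h => ENNReal.ofReal (potential x h))
      (ENNReal.ofReal γ) (fun h => by
        rw [← ENNReal.ofReal_mul hγ0]
        exact expect_potential_le hx hS (cand h) h (hcand x h))
      (fun h hlt => by
        rw [ENNReal.ofReal_lt_one] at hlt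
        simp only [collectGuesses, bestGuess_eq_of_potential_lt_one _ hlt])
    have hfail : γ ^ T * potential x [] ≤ δ := by
      have hγexp : γ ^ T ≤ (n : ℝ) ^ (-(β + 3)) := by
        have h1 : γ ≤ Real.exp (-(1 / D)) := by
          have := Real.add_one_le_exp (-(1 / D))
          rw [hγ]
          linarith
        calc γ ^ T ≤ Real.exp (-(1 / D)) ^ T := pow_le_pow_left₀ hγ0 h1 T
          _ = Real.exp (-(T / D)) := by
              rw [← Real.exp_nat_mul]
              congr 1
              ring
          _ ≤ Real.exp (Real.log n * -(β + 3)) := by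
              apply Real.exp_le_exp.2
              have : (β + 3) * Real.log n ≤ T / D := by
                rw [le_div_iff₀ (by linarith), mul_comm]
                exact hTge
              linarith
          _ = _ := (Real.rpow_def_of_pos (by linarith) _).symm
      calc γ ^ T * potential x [] ≤ (n : ℝ) ^ (-(β + 3)) * (2 * (n : ℝ) ^ 2) :=
            mul_le_mul hγexp (potential_nil_le x) (potential_nonneg _ _) (by positivity)
        _ ≤ (n : ℝ) ^ (-(β + 3)) * (n : ℝ) ^ (3 : ℝ) := by
            gcongr
            rw [show (3 : ℝ) = (3 : ℕ) by norm_num, Real.rpow_natCast]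
            nlinarith [sq_nonneg (n : ℝ)]
        _ = (n : ℝ) ^ (-β) := by
            rw [← Real.rpow_add (by linarith)]
            congr 1
            ring
        _ ≤ δ := hδ.le
    rw [ENNReal.ofReal_sub _ (le_trans (by positivity) hδ.le), ENNReal.ofReal_one]
    refine tsub_le_iff_right.2 (key.trans ?_)
    rw [← ENNReal.ofReal_pow hγ0, ← ENNReal.ofReal_mul (by positivity), successProb_eq]
    exact add_le_add (le_iSup (fun t => runValue A (answer _ hS) _ t []) (T + 1))
      (ENNReal.ofReal_le_ofReal hfail)
  · refine iSup_le fun S => iSup₂_le fun hS _ => (maxQueries_prober_le T cand _ S hS).trans ?_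
    rw [← ENNReal.ofReal_natCast]
    exact ENNReal.ofReal_le_ofReal hTle

/-- The median of the weights of the candidates for the `j`-th smallest hidden element. -/
def weightMedian (hn : 0 < n) (h : Transcript n) (j : Fin k) : Fin n :=
  (exists_isMedian hn (W := fun z => Real.exp (1 / (4 * (k : ℝ)) * score (level j) h z))
    fun _ => (Real.exp_pos _).le).choose

/-- The algorithm does not know `x₀`, but relative weights differ from the absolute ones by a common
positive factor, so their median is the same. -/
lemma isMedian_weightMedian (hn : 0 < n) (h : Transcript n) (j : Fin k) (x₀ : Fin n) :
    IsMedian (relWeight (level j) (1 / (4 * k)) x₀ h) (weightMedian hn h j) := by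
  have := (exists_isMedian hn (W := fun z => Real.exp (1 / (4 * (k : ℝ)) * score (level j) h z))
    fun _ => (Real.exp_pos _).le).choose_spec.mul_const
      (Real.exp_pos (-(1 / (4 * (k : ℝ)) * score (level j) h x₀)))
  simp only [← Real.exp_add, ← sub_eq_add_neg, ← mul_sub] at this
  exact this

theorem upper_bound (hn : 2 ≤ n) (hk : 1 ≤ k) {β δ : ℝ} (hβ : 0 < β) (hδ : (n : ℝ) ^ (-β) < δ) :
    worstCaseComplexity n k δ ≤
      ENNReal.ofReal ((64 * (β + 3) + 2) * ((k : ℝ) ^ 2 * (min k n : ℕ) * Real.log n)) := by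
  have hkR : (0 : ℝ) < k := by exact_mod_cast hk
  have hnR : (0 : ℝ) < n := by exact_mod_cast (by omega : 0 < n)
  rcases le_total k n with hkn | hkn
  · have : Nonempty (Fin k) := ⟨⟨0, hk⟩⟩
    rw [min_eq_left hkn]
    refine worstCaseComplexity_le_of_candidates (ι := Fin k × Bool) hn hk hβ hδ hk
      (fun h i => if i.2 then weightMedian (by omega) h i.1
        else prev (weightMedian (by omega) h i.1)) fun x h j => ?_
    have hW := fun z => (relWeight_pos (level j) (1 / (4 * (k : ℝ))) (x j) h z).le
    have h1 := sum_ne_le_oppWeight_add hW (isMedian_weightMedian (by omega) h j (x j)) (x j)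
    rw [Fintype.sum_prod_type]
    -- Only the two queries chosen for rank `j` itself are counted: they separate half of its wrong
    -- weight, out of `2 * k` candidates.
    refine le_trans ?_ (Finset.single_le_sum
      (fun i _ => Finset.sum_nonneg fun b _ => oppWeight_nonneg hW _ _) (Finset.mem_univ j))
    have h2 : (Fintype.card (Fin k × Bool) : ℝ) * (1 / (4 * k)) = 1 / 2 := by
      simp only [Fintype.card_prod, Fintype.card_fin, Fintype.card_bool, Nat.cast_mul]
      field_simp
      norm_num
    rw [h2]
    simp only [Fintype.sum_bool, if_true, Bool.false_eq_true, if_false]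
    unfold wrongWeight
    linarith
  · have : Nonempty (Fin n) := ⟨⟨0, by omega⟩⟩
    rw [min_eq_right hkn]
    refine worstCaseComplexity_le_of_candidates (ι := Fin n) hn hk hβ hδ (by omega)
      (fun _ i => i) fun x h j => ?_
    have hW := fun z => (relWeight_pos (level j) (1 / (4 * (k : ℝ))) (x j) h z).le
    have h1 := sum_ne_le_sum_oppWeight hW (x j)
    have h2 : (Fintype.card (Fin n) : ℝ) * (1 / (4 * n)) = 1 / 4 := by
      simp only [Fintype.card_fin]
      field_simp
    have h3 := wrongWeight_nonneg x h j
    rw [h2]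
    unfold wrongWeight at *
    linarith

end upper

end HiddenMultiset

end

theorem theorem1 :
    ∃ c : ℝ, 0 < c ∧ ∀ β : ℝ, 0 < β → ∃ C : ℝ, 0 < C ∧
      ∀ (n k : ℕ) (δ : ℝ), 1 ≤ n → 1 ≤ k → (n : ℝ) ^ (-β) < δ → δ < 1 / 4 →
        HiddenMultiset.expectedComplexity n k δ ≤ HiddenMultiset.worstCaseComplexity n k δ ∧
        (k ≤ n →
          ENNReal.ofReal (c * ((k : ℝ) ^ 3 * Real.log n)) ≤
              HiddenMultiset.expectedComplexity n k δ ∧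
            HiddenMultiset.worstCaseComplexity n k δ ≤
              ENNReal.ofReal (C * ((k : ℝ) ^ 3 * Real.log n))) ∧
        (n ≤ k →
          ENNReal.ofReal (c * ((k : ℝ) ^ 2 * n * Real.log n)) ≤
              HiddenMultiset.expectedComplexity n k δ ∧
            HiddenMultiset.worstCaseComplexity n k δ ≤
              ENNReal.ofReal (C * ((k : ℝ) ^ 2 * n * Real.log n))) := by
  refine ⟨1 / 350, by norm_num, fun β hβ => ⟨64 * (β + 3) + 2, by linarith, ?_⟩⟩
  intro n k δ hn hk hδ1 hδ2
  -- For `n = 1` the hypotheses would give `1 < δ < 1 / 4`.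
  have hn2 : 2 ≤ n := by
    by_contra h
    obtain rfl : n = 1 := by omega
    rw [Nat.cast_one, Real.one_rpow] at hδ1
    linarith
  have hl := HiddenMultiset.lower_bound (k := k) hn2 hk hδ2
  have hu := HiddenMultiset.upper_bound (k := k) hn2 hk hβ hδ1
  refine ⟨HiddenMultiset.expectedComplexity_le_worstCaseComplexity n k δ, fun h => ?_, fun h => ?_⟩
  · rw [min_eq_left h, show (k : ℝ) ^ 2 * (k : ℝ) = (k : ℝ) ^ 3 by ring] at hl hu
    exact ⟨hl, hu⟩
  · rw [min_eq_right h] at hl hu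
    exact ⟨hl, hu⟩
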